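/- Let $n\ge 0$ be an integer and let $\Gamma$ be an infinite amenable group. Assume that $\Gamma$ is residually finite, i.e. that it admits a *residual chain*: a nested sequence $\Gamma=\Lambda_0\ge\Lambda_1\ge\cdots$ of finite index normal subgroups of $\Gamma$ with $\bigcap_{i}\Lambda_i=\{1\}$. Assume further that $\Gamma$ is of type $\mathsf{FP}_n$, i.e. that the trivial $\mathbb{Z}\Gamma$-module $\mathbb{Z}$ has a projective resolution $P$ such that the $\mathbb{Z}\Gamma$-module $P_j$ is finitely generated for all $j\le n$. (A group $\Gamma$ is amenable if it satisfies the Følner condition: for every finite $S\subset\Gamma$ and every $\varepsilon>0$ there is a non-empty finite $F\subset\Gamma$ with $\#\{\gamma\in F\mid \gamma s\notin F\text{ for some }s\in S\}\le\varepsilon\cdot\#F$.) Then for every residual chain $(\Lambda_i)_{i}$ in $\Gamma$ the following hold: 1. for all integers $0\le j\le n-1$, $$\limsup_{i\to\infty}\frac{\log \operatorname{tors} H_j(\Lambda_i;\mathbb{Z})}{[\Gamma:\Lambda_i]}=0,$$ where $\operatorname{tors}$ denotes the cardinality of the torsion subgroup, with $\log\infty:=\infty$; 2. for every field $\mathbb{F}$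 and all integers $0\le j\le n$, $$\limsup_{i\to\infty}\frac{\dim_{\mathbb{F}} H_j(\Lambda_i;\mathbb{F})}{[\Gamma:\Lambda_i]}=0.$$ In other words, $\Gamma$ lies in the class $\mathsf{T}_{n-1}$ of residually finite groups satisfying 1, and in the class $\mathsf{H}_n(\mathbb{F})$ of residually finite groups satisfying the equation in 2, for every field $\mathbb{F}$. -/

import Mathlib

open CategoryTheory Filter
open scoped ENNReal

universe u v

noncomputable section

/-- A residual chain in `Γ`: a nested sequence `Γ = Λ 0 ≥ Λ 1 ≥ ⋯` of finite index normal
subgroups with trivial intersection. -/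
structure IsResidualChain {Γ : Type u} [Group Γ] (Λ : ℕ → Subgroup Γ) : Prop where
  zero_eq_top : Λ 0 = ⊤
  antitone : Antitone Λ
  normal : ∀ i, (Λ i).Normal
  finiteIndex : ∀ i, (Λ i).FiniteIndex
  iInf_eq_bot : ⨅ i, Λ i = ⊥

/-- A group is residually finite if it admits a residual chain. -/
def IsResiduallyFinite (Γ : Type u) [Group Γ] : Prop :=
  ∃ Λ : ℕ → Subgroup Γ, IsResidualChain Λ

/-- The boundary `∂_S F` of `F`: those `γ ∈ F` with `γ * s ∉ F` for some `s ∈ S`. -/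
def folnerBoundary {Γ : Type u} [Group Γ] (S F : Set Γ) : Set Γ :=
  {γ | γ ∈ F ∧ ∃ s ∈ S, γ * s ∉ F}

/-- A (discrete) group is amenable if it satisfies the Følner condition: for every finite subset
`S` and every `ε > 0` there is a non-empty finite subset `F` with `#(∂_S F) ≤ ε * #F`. -/
def IsAmenable (Γ : Type u) [Group Γ] : Prop :=
  ∀ (S : Finset Γ) (ε : ℝ), 0 < ε →
    ∃ F : Finset Γ, F.Nonempty ∧ ((folnerBoundary (S : Set Γ) F).ncard : ℝ) ≤ ε * F.card

/-- The trivial `ℤ[Γ]`-module `ℤ` (lifted to the universe of `Γ`). -/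
abbrev trivialModule (Γ : Type u) [Group Γ] : ModuleCat.{u} (MonoidAlgebra ℤ Γ) :=
  ModuleCat.of (MonoidAlgebra ℤ Γ) (Representation.trivial ℤ Γ (ULift.{u} ℤ)).asModule

/-- `Γ` is of type `FP_n`: the trivial `ℤ[Γ]`-module `ℤ` has a projective resolution `P` such that
the `ℤ[Γ]`-module `P_j` is finitely generated for all `j ≤ n`. -/
def IsOfTypeFP (Γ : Type u) [Group Γ] (n : ℕ) : Prop :=
  ∃ P : ProjectiveResolution (trivialModule Γ),
    ∀ j ≤ n, Module.Finite (MonoidAlgebra ℤ Γ) (P.complex.X j)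

/-- The group homology `H_j(G; k)` with coefficients in the trivial module `k`. The universe lifts
are there only because `groupHomology` wants the group and the ring in the same universe. -/
abbrev trivialHomology (k : Type v) [CommRing k] (G : Type u) [Group G] (j : ℕ) :
    ModuleCat.{max u v} (ULift.{u} k) :=
  groupHomology (Rep.trivial (ULift.{u} k) (ULift.{v} G) (ULift.{u} k)) j

/-- The Betti number `dim_F H_j(G; F)`, which is `⊤` if the dimension is infinite. -/
def bettiNumber (F : Type v) [Field F] (G : Type u) [Group G] (j : ℕ) : ℕ∞ :=
  (Module.rank (ULift.{u} F) (trivialHomology F G j)).toENat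

/-- The cardinality of the torsion subgroup of `H_j(G; ℤ)`, which is `⊤` if it is infinite. -/
def torsionCard (G : Type u) [Group G] (j : ℕ) : ℕ∞ :=
  ENat.card (AddCommGroup.torsion (trivialHomology ℤ G j))

/-- The Betti number gradient `limsup_i dim_F H_j(Λ_i; F) / [Γ : Λ_i]`. -/
def bettiGradient (F : Type v) [Field F] {Γ : Type u} [Group Γ] (Λ : ℕ → Subgroup Γ) (j : ℕ) :
    ℝ≥0∞ :=
  limsup (fun i => (bettiNumber F (Λ i) j : ℝ≥0∞) / ((Λ i).index : ℝ≥0∞)) atTop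

/-- The torsion homology gradient `limsup_i log (tors H_j(Λ_i; ℤ)) / [Γ : Λ_i]`, where
`ENNReal.log ⊤ = ⊤`. -/
def torsionGradient {Γ : Type u} [Group Γ] (Λ : ℕ → Subgroup Γ) (j : ℕ) : EReal :=
  limsup (fun i => ENNReal.log (torsionCard (Λ i) j : ℝ≥0∞) / ((Λ i).index : EReal)) atTop

/-- `Γ` lies in `H_n(F)`: it is residually finite and its Betti number gradients over `F` vanish
in all degrees `≤ n` along all residual chains. -/
def MemH (F : Type v) [Field F] (n : ℤ) (Γ : Type u) [Group Γ] : Prop :=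
  IsResiduallyFinite Γ ∧
    ∀ Λ : ℕ → Subgroup Γ, IsResidualChain Λ → ∀ j : ℕ, (j : ℤ) ≤ n → bettiGradient F Λ j = 0

/-- `Γ` lies in `T_n`: it is residually finite and its torsion homology gradients vanish in all
degrees `≤ n` along all residual chains. -/
def MemT (n : ℤ) (Γ : Type u) [Group Γ] : Prop :=
  IsResiduallyFinite Γ ∧
    ∀ Λ : ℕ → Subgroup Γ, IsResidualChain Λ → ∀ j : ℕ, (j : ℤ) ≤ n → torsionGradient Λ j = 0

end

open scoped TensorProduct

noncomputable section

/-! Fix a residual chain, let `Q = Γ ⧸ Λ k`, and let `δ` be the differential `P_{j+1} → P_j`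
tensored with `K` and written in coordinates on `K[I × Γ]` and `K[J × Γ]`; finitely generated
projectives are retracts of such free modules. Restricted to `Λ k`, the complex `K ⊗ P` is a
projective resolution of `K`, so `H_{j+1}(Λ k; K)` consists of cycles over `Q` modulo boundaries. By
exactness over `Γ`, the boundaries are the image of `ker δ`: a cycle over `Q` that lifts to a cycle
over `Γ` is a boundary (`exists_injective_groupHomology`).

Amenability makes most of a cycle liftable. Cut `Q` into pieces, each inside a translate of the
image of one Følner set `F`, such that all but a fraction `ε` of the elements stay in their piece
under right multiplication by the finite set `S` that bounds the propagation of `δ`. Such a cut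
exists for every finite group: order `Q` at random and send `x` to the least `u` with `x ∈ u F`; an
average over the orders bounds the number of bad elements (`RandomOrder.exists_partition`). If a
cycle is supported off the bad set, its restriction to each piece is again a cycle, and it lifts to
`Γ` once `F * S` injects into `Q`, which holds far along the chain (`mem_map_ker_of_partition`).
Hence the homology still embeds after all good basis vectors are killed, into a module with at most
`#I * #bad` generators, where `#bad ≤ ε [Γ : Λ k]` (`exists_injective_of_partition`).

Over a field this bounds the dimension. Over `ℤ`, if `P_{j+2}` is also finitely generated, then `ker
δ` is generated by translates of finitely many vectors, so the relations have norm at most a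
constant `c` independent of `k`. A determinant estimate then bounds the torsion by `c` to the number
of generators (`card_torsion_le_pow`). The additional module `P_{j+2}` accounts for the loss of one
degree in the torsion statement. Degree `0` is treated directly. -/

/-! ### Integral splittings of projective resolutions over group rings -/

/-- The additive map underlying a linear map, as a `ℤ`-linear map. -/
def LinearMap.toInt {R M N : Type*} [Ring R] [AddCommGroup M] [AddCommGroup N] [Module R M]
    [Module R N] (f : M →ₗ[R] N) : M →ₗ[ℤ] N :=
  f.toAddMonoidHom.toIntLinearMap

@[simp] lemma LinearMap.toInt_apply {R M N : Type*} [Ring R] [AddCommGroup M] [AddCommGroup N]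
    [Module R M] [Module R N] (f : M →ₗ[R] N) (x : M) : f.toInt x = f x := rfl

/-- A projective module over an integral group ring is projective over `ℤ`. -/
lemma projective_int_of_projective_monoidAlgebra {Γ : Type*} [Group Γ] (P : Type*)
    [AddCommGroup P] [Module (MonoidAlgebra ℤ Γ) P] [hP : Module.Projective (MonoidAlgebra ℤ Γ) P] :
    Module.Projective ℤ P := by
  obtain ⟨s, hs⟩ := hP.out
  have : Module.Free ℤ (MonoidAlgebra ℤ Γ) := inferInstance
  refine Module.Projective.of_split (M := P →₀ MonoidAlgebra ℤ Γ) s.toInt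
    (Finsupp.linearCombination (MonoidAlgebra ℤ Γ) id).toInt ?_
  ext x
  simpa using hs x

/-- One step in the construction of a contraction of an exact complex. -/
lemma exists_contraction_step {M₀ M₁ M₂ M₃ : Type*} [AddCommGroup M₀] [AddCommGroup M₁]
    [AddCommGroup M₂] [AddCommGroup M₃] [Module.Projective ℤ M₂]
    (d₁ : M₁ →ₗ[ℤ] M₀) (d₂ : M₂ →ₗ[ℤ] M₁) (d₃ : M₃ →ₗ[ℤ] M₂)
    (h₁₂ : ∀ x, d₁ (d₂ x) = 0) (h₂₃ : ∀ x, d₂ x = 0 → ∃ y, d₃ y = x)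
    (s : M₀ →ₗ[ℤ] M₁) (t : M₁ →ₗ[ℤ] M₂) (hst : ∀ x, d₂ (t x) + s (d₁ x) = x) :
    ∃ t' : M₂ →ₗ[ℤ] M₃, ∀ x, d₃ (t' x) + t (d₂ x) = x := by
  have hk : ∀ x : M₂, (LinearMap.id - t ∘ₗ d₂ : M₂ →ₗ[ℤ] M₂) x ∈ LinearMap.ker d₂ := fun x => by
    have := hst (d₂ x)
    rw [h₁₂, map_zero, add_zero] at this
    simp [this]
  have hr : ∀ x : M₂, (LinearMap.id - t ∘ₗ d₂ : M₂ →ₗ[ℤ] M₂) x ∈ LinearMap.range d₃ := fun x => by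
    obtain ⟨y, hy⟩ := h₂₃ _ (hk x)
    exact ⟨y, hy⟩
  -- `id - t ∘ d₂` takes values in `ker d₂ = range d₃`, so projectivity of `M₂` lifts it through
  -- `d₃`.
  obtain ⟨t', ht'⟩ := Module.projective_lifting_property d₃.rangeRestrict
    (LinearMap.codRestrict _ (LinearMap.id - t ∘ₗ d₂) hr) d₃.surjective_rangeRestrict
  refine ⟨t', fun x => ?_⟩
  have := congrArg Subtype.val (LinearMap.congr_fun ht' x)
  simp only [LinearMap.comp_apply, LinearMap.codRestrict_apply,
    LinearMap.sub_apply, LinearMap.id_apply] at this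
  have h2 : d₃ (t' x) = x - t (d₂ x) := this
  rw [h2]; abel

namespace CategoryTheory.ProjectiveResolution

variable {Γ : Type u} [Group Γ] {M : ModuleCat.{u} (MonoidAlgebra ℤ Γ)}
  (P : ProjectiveResolution M)

instance (n : ℕ) : Module.Projective (MonoidAlgebra ℤ Γ) (P.complex.X n) :=
  (IsProjective.iff_projective (P.complex.X n)).2 (P.projective n)

instance (n : ℕ) : Module.Projective ℤ (P.complex.X n) :=
  projective_int_of_projective_monoidAlgebra (Γ := Γ) (P.complex.X n)

/-- The augmentation of a projective resolution. -/
def augHom : P.complex.X 0 ⟶ M := P.π.f 0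

lemma d_comp_augHom : P.complex.d 1 0 ≫ P.augHom = 0 := P.complex_d_comp_π_f_zero

/-- The augmentation of a projective resolution, as a linear map. -/
def aug : P.complex.X 0 →ₗ[MonoidAlgebra ℤ Γ] M := P.augHom.hom

lemma aug_surjective : Function.Surjective P.aug :=
  (ModuleCat.epi_iff_surjective (P.π.f 0 : P.complex.X 0 ⟶ M)).1
    (inferInstanceAs (Epi (P.π.f 0)))

lemma d_d_apply (i j k : ℕ) (x : P.complex.X i) :
    (P.complex.d j k).hom ((P.complex.d i j).hom x) = 0 := by
  exact congrArg (fun f => f.hom x) (P.complex.d_comp_d i j k)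

lemma aug_d_apply (x : P.complex.X 1) : P.aug ((P.complex.d 1 0).hom x) = 0 :=
  congrArg (fun f => f.hom x) P.complex_d_comp_π_f_zero

lemma exists_d_eq (n : ℕ) (x : P.complex.X (n + 1)) (hx : (P.complex.d (n + 1) n).hom x = 0) :
    ∃ y, (P.complex.d (n + 2) (n + 1)).hom y = x :=
  (ShortComplex.moduleCat_exact_iff _).1 (P.exact_succ n) x hx

lemma exists_d_eq_of_aug (x : P.complex.X 0) (hx : P.aug x = 0) :
    ∃ y, (P.complex.d 1 0).hom y = x :=
  (ShortComplex.moduleCat_exact_iff _).1 P.exact₀ x hx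

lemma exists_contraction_zero [Module.Projective ℤ M] :
    ∃ (s : M →ₗ[ℤ] P.complex.X 0) (t : P.complex.X 0 →ₗ[ℤ] P.complex.X 1),
      (∀ x, P.aug (s x) = x) ∧ ∀ x, (P.complex.d 1 0).hom (t x) + s (P.aug x) = x := by
  obtain ⟨s, hs⟩ := Module.projective_lifting_property P.aug.toInt LinearMap.id P.aug_surjective
  have hs' : ∀ x, P.aug (s x) = x := fun x => LinearMap.congr_fun hs x
  -- The augmented complex is extended by zero, so the section `s` of the augmentation serves as the
  -- preceding homotopy.
  obtain ⟨t, ht⟩ := exists_contraction_step (M₀ := PUnit.{1}) 0 P.aug.toInt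
    (P.complex.d 1 0).hom.toInt
    (fun _ => rfl) P.exists_d_eq_of_aug 0 s (fun x => by simp [hs'])
  exact ⟨s, t, hs', ht⟩

/-- An additive contraction, unlike exactness alone, is preserved by `K ⊗ -` for every ring `K`. It
need not be `Γ`-equivariant. -/
lemma exists_contraction_succ [Module.Projective ℤ M] (n : ℕ) :
    ∃ (s : P.complex.X n →ₗ[ℤ] P.complex.X (n + 1))
      (t : P.complex.X (n + 1) →ₗ[ℤ] P.complex.X (n + 2)),
      ∀ x, (P.complex.d (n + 2) (n + 1)).hom (t x) + s ((P.complex.d (n + 1) n).hom x) = x := by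
  induction n with
  | zero =>
    obtain ⟨s, t, -, ht⟩ := P.exists_contraction_zero
    obtain ⟨t', ht'⟩ := exists_contraction_step P.aug.toInt (P.complex.d 1 0).hom.toInt
      (P.complex.d 2 1).hom.toInt P.aug_d_apply (P.exists_d_eq 0) s t ht
    exact ⟨t, t', ht'⟩
  | succ n ih =>
    obtain ⟨s, t, ht⟩ := ih
    obtain ⟨t', ht'⟩ := exists_contraction_step (P.complex.d (n + 1) n).hom.toInt
      (P.complex.d (n + 2) (n + 1)).hom.toInt (P.complex.d (n + 3) (n + 2)).hom.toInt
      (P.d_d_apply _ _ _) (P.exists_d_eq (n + 1)) s t ht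
    exact ⟨t, t', ht'⟩

end CategoryTheory.ProjectiveResolution

/-! ### Extension of scalars and restriction to a subgroup, as a functor to representations -/

namespace GroupRingBaseChange

variable {Γ : Type u} [Group Γ]

/-- The action of a group element on a module over the integral group ring. -/
def act (M : Type*) [AddCommGroup M] [Module (MonoidAlgebra ℤ Γ) M] (g : Γ) : M →ₗ[ℤ] M :=
  (DistribSMul.toAddMonoidHom M (MonoidAlgebra.single g (1 : ℤ))).toIntLinearMap

lemma act_apply {M : Type*} [AddCommGroup M] [Module (MonoidAlgebra ℤ Γ) M] (g : Γ) (x : M) :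
    act M g x = MonoidAlgebra.single g (1 : ℤ) • x := rfl

variable (K : Type (max u v)) [CommRing K] {G : Type (max u v)} [Group G] (f : G →* Γ)

/-- The representation of `G` on `K ⊗ M` obtained from a `ℤ[Γ]`-module `M` and a homomorphism
`G →* Γ`. -/
def rep (M : Type u) [AddCommGroup M] [Module (MonoidAlgebra ℤ Γ) M] :
    Representation K G (K ⊗[ℤ] M) where
  toFun g := (act M (f g)).baseChange K
  map_one' := by
    ext x
    simp [act_apply, ← MonoidAlgebra.one_def]
  map_mul' g h := by
    ext x
    simp [act_apply, smul_smul, MonoidAlgebra.single_mul_single]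

@[simp] lemma rep_tmul (M : Type u) [AddCommGroup M] [Module (MonoidAlgebra ℤ Γ) M] (g : G)
    (a : K) (x : M) : rep K f M g (a ⊗ₜ x) = a ⊗ₜ (MonoidAlgebra.single (f g) (1 : ℤ) • x) := rfl

/-- The functor `M ↦ K ⊗ M` from `ℤ[Γ]`-modules to `K`-linear representations of `G`. -/
def functor : ModuleCat.{u} (MonoidAlgebra ℤ Γ) ⥤ Rep.{max u v} K G where
  obj M := Rep.of (rep K f M)
  map {M N} h := Rep.ofHom
    { h.hom.toInt.baseChange K with
      isIntertwining' := fun g => by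
        apply TensorProduct.AlgebraTensorModule.ext
        intro a x
        simp [LinearMap.toInt, map_smul] }
  map_id M := by
    ext : 2
    apply TensorProduct.AlgebraTensorModule.ext
    intro a x
    rfl
  map_comp h h' := by
    ext : 2
    apply TensorProduct.AlgebraTensorModule.ext
    intro a x
    rfl

instance : (functor K f).Additive where
  map_add {M N h h'} := by
    ext : 2
    apply TensorProduct.AlgebraTensorModule.ext
    intro a x
    exact TensorProduct.tmul_add a (h.hom x) (h'.hom x)

end GroupRingBaseChange

lemma Rep.exact_iff {w : Type u} [Group w] {K : Type u} [CommRing K]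
    (S : ShortComplex (Rep.{u} K w)) :
    S.Exact ↔ ∀ x, S.g.hom x = 0 → ∃ y, S.f.hom y = x := by
  rw [← S.exact_map_iff_of_faithful (forget₂ (Rep.{u} K w) (ModuleCat K)),
    ShortComplex.moduleCat_exact_iff]
  rfl

/-- An exact augmented chain complex resolves its augmentation object. -/
lemma ChainComplex.quasiIso_toSingle₀ {C : Type*} [Category C] [Abelian C] (X : ChainComplex C ℕ)
    {Z : C} (ε : X.X 0 ⟶ Z) (w : X.d 1 0 ≫ ε = 0) [Epi ε] (h₀ : (ShortComplex.mk _ _ w).Exact)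
    (h : ∀ n, X.ExactAt (n + 1)) :
    QuasiIso ((ChainComplex.toSingle₀Equiv X Z).symm ⟨ε, w⟩) := ⟨fun n => by
  cases n
  · rw [ChainComplex.quasiIsoAt₀_iff, ShortComplex.quasiIso_iff_of_zeros']
    · refine (ShortComplex.exact_and_epi_g_iff_of_iso ?_).2 ⟨h₀, by dsimp; infer_instance⟩
      exact ShortComplex.isoMk (Iso.refl _) (Iso.refl _) (Iso.refl _)
        ((Category.id_comp _).trans (Category.comp_id _).symm)
        ((Category.id_comp _).trans
          ((ChainComplex.toSingle₀Equiv_symm_apply_f_zero ε w).symm.trans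
            (Category.comp_id _).symm))
    · exact X.shape _ _ (by simp)
    all_goals rfl
  · rw [quasiIsoAt_iff_exactAt']
    · exact h _
    · apply ChainComplex.exactAt_succ_single_obj⟩

/-- An injective homomorphism `f : G →* Γ` admits a `G`-equivariant retraction `Γ → G` of sets. -/
lemma MonoidHom.exists_equivariant_retraction {G Γ : Type*} [Group G] [Group Γ] (f : G →* Γ)
    (hf : Function.Injective f) : ∃ c : Γ → G, ∀ g γ, c (f g * γ) = g * c γ := by
  let q : Γ → Quotient (QuotientGroup.rightRel f.range) := Quotient.mk _
  have hq : ∀ g γ, q (f g * γ) = q γ := fun g γ => Quotient.sound <| by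
    rw [← Quotient.eq_iff_equiv, Quotient.eq, QuotientGroup.rightRel_apply]
    exact ⟨g⁻¹, by simp⟩
  have hc : ∀ γ, ∃ g, f g * (q γ).out = γ := fun γ => by
    have h : QuotientGroup.rightRel f.range (q γ).out γ := Quotient.mk_out γ
    rw [QuotientGroup.rightRel_apply] at h
    obtain ⟨g, hg⟩ := h
    exact ⟨g, by rw [hg]; simp⟩
  choose c hc using hc
  refine ⟨c, fun g γ => hf ?_⟩
  have h1 := hc (f g * γ)
  rw [hq] at h1
  rw [map_mul, ← mul_left_inj (q γ).out, h1, mul_assoc, hc]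

/-! ### Projectivity and exactness of the base-changed resolution -/

namespace GroupRingBaseChange

variable {Γ : Type u} [Group Γ] (K : Type (max u v)) [CommRing K] {G : Type (max u v)} [Group G]
  (f : G →* Γ)

/-- The additive map on a free `ℤ[Γ]`-module determined by its values on the integral basis. -/
def liftBasis {I E : Type*} [AddCommGroup E] (h : I → Γ → E) :
    (I →₀ MonoidAlgebra ℤ Γ) →+ E :=
  Finsupp.liftAddHom fun i =>
    (Finsupp.liftAddHom fun γ => (smulAddHom ℤ E).flip (h i γ)).comp
      MonoidAlgebra.coeffAddEquiv.toAddMonoidHom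

lemma liftBasis_single {I E : Type*} [AddCommGroup E] (h : I → Γ → E) (i : I) (γ : Γ) (n : ℤ) :
    liftBasis h (Finsupp.single i (MonoidAlgebra.single γ n)) = n • h i γ := by
  simp [liftBasis]

lemma addHom_ext_basis {I E : Type*} [AddCommGroup E] {φ ψ : (I →₀ MonoidAlgebra ℤ Γ) →+ E}
    (h : ∀ i γ, φ (Finsupp.single i (MonoidAlgebra.single γ 1)) =
      ψ (Finsupp.single i (MonoidAlgebra.single γ 1))) : φ = ψ := by
  refine Finsupp.addHom_ext' fun i => ?_
  refine MonoidAlgebra.addMonoidHom_ext fun γ => ?_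
  refine DFunLike.congr_fun (AddMonoidHom.ext_int (f := (φ.comp (Finsupp.singleAddHom i)).comp
    (MonoidAlgebra.singleAddHom γ)) (g := (ψ.comp (Finsupp.singleAddHom i)).comp
    (MonoidAlgebra.singleAddHom γ)) ?_)
  exact h i γ

/-- Since `f` is injective, `Γ` is a free left `G`-set, so lifts may be chosen freely on coset
representatives of the integral basis of `M →₀ ℤ[Γ]`. The section `s` exhibits `M` as a retract of
that free module. -/
lemma projective_functor_obj (hf : Function.Injective f) (M : ModuleCat.{u} (MonoidAlgebra ℤ Γ))
    [hM : Module.Projective (MonoidAlgebra ℤ Γ) M] : Projective ((functor K f).obj M) where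
  factors {E X} φ e he := by
    obtain ⟨c, hc⟩ := f.exists_equivariant_retraction hf
    obtain ⟨s, hs⟩ := hM.out
    have he' := (Rep.epi_iff_surjective e).1 he
    have hc' : ∀ g γ, (f (c (f g * γ)))⁻¹ * (f g * γ) = (f (c γ))⁻¹ * γ := fun g γ => by
      rw [hc, map_mul, mul_inv_rev]; group
    choose y hy using he'
    -- Here `γ` is `f (c γ)` times a factor that depends only on the coset of `γ`, by `hc'`. The
    -- lift is chosen at that factor and transported by `c γ`, which makes `h` equivariant in `γ`.
    let h : M → Γ → E := fun m γ =>
      E.ρ (c γ) (y (φ.hom ((1 : K) ⊗ₜ (MonoidAlgebra.single ((f (c γ))⁻¹ * γ) (1 : ℤ) • m))))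
    have hφ : ∀ (g : G) (m : M), φ.hom ((1 : K) ⊗ₜ[ℤ] (MonoidAlgebra.single (f g) (1 : ℤ) • m)) =
        X.ρ g (φ.hom ((1 : K) ⊗ₜ[ℤ] m)) := fun g m =>
      Rep.hom_comm_apply φ g ((1 : K) ⊗ₜ[ℤ] m)
    have heh : ∀ m γ, e.hom (h m γ) = φ.hom ((1 : K) ⊗ₜ (MonoidAlgebra.single γ (1 : ℤ) • m)) := by
      intro m γ
      have := Rep.hom_comm_apply e (c γ)
        (y (φ.hom ((1 : K) ⊗ₜ (MonoidAlgebra.single ((f (c γ))⁻¹ * γ) (1 : ℤ) • m))))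
      rw [this, hy, ← hφ, smul_smul, MonoidAlgebra.single_mul_single, mul_inv_cancel_left, one_mul]
    let L : M →ₗ[ℤ] E := ((liftBasis h).comp s.toAddMonoidHom).toIntLinearMap
    have hL : ∀ (g : G) (z : M →₀ MonoidAlgebra ℤ Γ),
        liftBasis h (MonoidAlgebra.single (f g) (1 : ℤ) • z) = E.ρ g (liftBasis h z) := by
      intro g z
      have : (liftBasis h).comp (DistribSMul.toAddMonoidHom _ (MonoidAlgebra.single (f g) (1 : ℤ)))
          = (E.ρ g).toAddMonoidHom.comp (liftBasis h) := by
        refine addHom_ext_basis fun m γ => ?_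
        simp only [AddMonoidHom.comp_apply, DistribSMul.toAddMonoidHom_apply, Finsupp.smul_single,
          smul_eq_mul, MonoidAlgebra.single_mul_single, one_mul, liftBasis_single, one_smul,
          LinearMap.toAddMonoidHom_coe, h, hc']
        rw [hc, map_mul]
        rfl
      exact DFunLike.congr_fun this z
    have heL : ∀ z : M →₀ MonoidAlgebra ℤ Γ, e.hom (liftBasis h z) =
        φ.hom ((1 : K) ⊗ₜ (Finsupp.linearCombination (MonoidAlgebra ℤ Γ) id z)) := by
      intro z
      have : e.hom.toLinearMap.toAddMonoidHom.comp (liftBasis h) =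
          (φ.hom.toLinearMap.toAddMonoidHom.comp
            ((TensorProduct.mk ℤ K M 1).toAddMonoidHom)).comp
              (Finsupp.linearCombination (MonoidAlgebra ℤ Γ) (id : M → M)).toAddMonoidHom := by
        refine addHom_ext_basis fun m γ => ?_
        simp only [AddMonoidHom.comp_apply, liftBasis_single, one_smul,
          LinearMap.toAddMonoidHom_coe, Finsupp.linearCombination_single, id]
        exact heh m γ
      exact DFunLike.congr_fun this z
    refine ⟨Rep.ofHom
      { L.liftBaseChange K with
        isIntertwining' := fun g => ?_ }, ?_⟩
    · refine TensorProduct.AlgebraTensorModule.ext fun a m => ?_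
      change a • liftBasis h (s (MonoidAlgebra.single (f g) (1 : ℤ) • m)) =
        E.ρ g (a • liftBasis h (s m))
      rw [map_smul, hL, map_smul]
    · ext : 2
      refine TensorProduct.AlgebraTensorModule.ext fun a m => ?_
      change e.hom (a • liftBasis h (s m)) = φ.hom (a ⊗ₜ m)
      rw [map_smul, heL, hs]
      refine (φ.hom.toLinearMap.map_smul a ((1 : K) ⊗ₜ[ℤ] m)).symm.trans ?_
      exact congrArg φ.hom.toLinearMap
        (show a • ((1 : K) ⊗ₜ[ℤ] m) = a ⊗ₜ[ℤ] m by
          rw [TensorProduct.smul_tmul', smul_eq_mul, mul_one])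

instance : Module.Projective ℤ (trivialModule Γ) :=
  inferInstanceAs (Module.Projective ℤ (ULift.{u} ℤ))

lemma single_smul_trivialModule (g : Γ) (x : trivialModule Γ) :
    MonoidAlgebra.single g (1 : ℤ) • x = x := by
  have := Representation.single_smul (Representation.trivial ℤ Γ (ULift.{u} ℤ)) 1 g x
  rw [one_smul] at this
  exact this

/-- The base change of the trivial module is the trivial representation. -/
def trivialIso :
    (functor K f).obj (trivialModule Γ) ≅ Rep.trivial K G K :=
  Rep.mkIso <| Representation.Equiv.mk
    ((TensorProduct.AlgebraTensorModule.congr (LinearEquiv.refl K K)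
      (ULift.moduleEquiv : ULift.{u} ℤ ≃ₗ[ℤ] ℤ)).trans
        (TensorProduct.AlgebraTensorModule.rid ℤ K K))
    (fun g => by
      refine TensorProduct.AlgebraTensorModule.ext fun a m => ?_
      exact congrArg (fun z : ULift.{u} ℤ => z.down • a) (single_smul_trivialModule (f g) m))

variable (P : ProjectiveResolution (trivialModule Γ))

/-- The base change of a projective resolution. -/
abbrev complex : ChainComplex (Rep.{max u v} K G) ℕ :=
  ((functor K f).mapHomologicalComplex _).obj P.complex

/-- The base changed augmentation. -/
def aug : (complex K f P).X 0 ⟶ Rep.trivial K G K :=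
  (functor K f).map P.augHom ≫ (trivialIso K f).hom

lemma d_comp_aug : (complex K f P).d 1 0 ≫ aug K f P = 0 := by
  change (functor K f).map (P.complex.d 1 0) ≫ (functor K f).map P.augHom ≫ _ = 0
  rw [← Category.assoc, ← Functor.map_comp, P.d_comp_augHom, Functor.map_zero,
    Limits.zero_comp]

lemma exists_d_eq (n : ℕ) (x : K ⊗[ℤ] P.complex.X (n + 1))
    (hx : ((complex K f P).d (n + 1) n).hom x = 0) :
    ∃ y : K ⊗[ℤ] P.complex.X (n + 2), ((complex K f P).d (n + 2) (n + 1)).hom y = x := by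
  obtain ⟨s, t, h⟩ := P.exists_contraction_succ n
  refine ⟨t.baseChange K x, ?_⟩
  have key : ((P.complex.d (n + 2) (n + 1)).hom.toInt.baseChange K ∘ₗ t.baseChange K +
      s.baseChange K ∘ₗ (P.complex.d (n + 1) n).hom.toInt.baseChange K) = LinearMap.id := by
    refine TensorProduct.AlgebraTensorModule.ext fun a m => ?_
    simp [← TensorProduct.tmul_add, h]
  have hx' : (P.complex.d (n + 1) n).hom.toInt.baseChange K x = 0 := hx
  have := LinearMap.congr_fun key x
  rw [LinearMap.add_apply, LinearMap.comp_apply, LinearMap.comp_apply, hx', map_zero,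
    add_zero] at this
  exact this

lemma exists_d_eq_of_aug (x : K ⊗[ℤ] P.complex.X 0) (hx : (aug K f P).hom x = 0) :
    ∃ y : K ⊗[ℤ] P.complex.X 1, ((complex K f P).d 1 0).hom y = x := by
  obtain ⟨s, t, -, h⟩ := P.exists_contraction_zero
  refine ⟨t.baseChange K x, ?_⟩
  have key : ((P.complex.d 1 0).hom.toInt.baseChange K ∘ₗ t.baseChange K +
      s.baseChange K ∘ₗ P.aug.toInt.baseChange K) = LinearMap.id := by
    refine TensorProduct.AlgebraTensorModule.ext fun a m => ?_
    simp [← TensorProduct.tmul_add, h]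
  have hx' : P.aug.toInt.baseChange K x = 0 := by
    have h2 := congrArg (trivialIso K f).inv.hom hx
    rw [map_zero] at h2
    refine Eq.trans ?_ h2
    exact (congrArg (fun φ => φ.hom (P.aug.toInt.baseChange K x))
      (trivialIso K f).hom_inv_id).symm
  have := LinearMap.congr_fun key x
  rw [LinearMap.add_apply, LinearMap.comp_apply, LinearMap.comp_apply, hx', map_zero,
    add_zero] at this
  exact this

lemma aug_surjective : Function.Surjective (aug K f P).hom := by
  intro z
  obtain ⟨s, -, h, -⟩ := P.exists_contraction_zero
  refine ⟨s.baseChange K ((trivialIso K f).inv.hom z), ?_⟩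
  have key : P.aug.toInt.baseChange K ∘ₗ s.baseChange K = LinearMap.id := by
    refine TensorProduct.AlgebraTensorModule.ext fun a m => ?_
    simp [h]
  have := LinearMap.congr_fun key ((trivialIso K f).inv.hom z)
  exact (congrArg (trivialIso K f).hom.hom this).trans 
    (congrArg (fun φ => φ.hom z) (trivialIso K f).inv_hom_id)

instance : Epi (aug K f P) := (Rep.epi_iff_surjective _).2 (aug_surjective K f P)

/-- The base change of a projective resolution of the trivial `ℤ[Γ]`-module along an injective
homomorphism `G →* Γ` is a projective resolution of the trivial `K`-linear representation. -/
def resolution (hf : Function.Injective f) : ProjectiveResolution (Rep.trivial K G K) where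
  complex := complex K f P
  projective n := projective_functor_obj K f hf (P.complex.X n)
  π := (ChainComplex.toSingle₀Equiv _ _).symm ⟨aug K f P, d_comp_aug K f P⟩
  quasiIso := by
    refine ChainComplex.quasiIso_toSingle₀ _ _ _ ?_ fun n => ?_
    · rw [Rep.exact_iff]
      exact exists_d_eq_of_aug K f P
    · rw [HomologicalComplex.exactAt_iff' _ (n + 1 + 1) (n + 1) n (by simp) (by simp),
        Rep.exact_iff]
      exact exists_d_eq K f P n

end GroupRingBaseChange

/-! ### Detecting group homology by an invariant map on a resolution -/

section HomologyEmbedding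

open Representation

/-- A linear map out of the chains of a complex of modules which has the boundaries as
preimage of zero induces an injection on homology. -/
lemma HomologicalComplex.exists_injective_of_homology {K : Type u} [Ring K]
    (C : ChainComplex (ModuleCat.{u} K) ℕ) (i : ℕ) {W : Type u} [AddCommGroup W] [Module K W]
    (ψ : C.X i →ₗ[K] W) (h₁ : ∀ y, ψ (C.d (i + 1) i y) = 0)
    (h₂ : ∀ x, ψ x = 0 → ∃ y, C.d (i + 1) i y = x) :
    ∃ f : C.homology i →ₗ[K] W, Function.Injective f ∧
      ∀ h, ∃ x, C.d i (i - 1) x = 0 ∧ f h = ψ x := by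
  have hw : C.d (i + 1) i ≫ ModuleCat.ofHom ψ = 0 := by
    ext y; exact h₁ y
  let F := C.homologyι i ≫ C.descOpcycles (ModuleCat.ofHom ψ) (i + 1) (by simp) hw
  have hF : ∀ z, F.hom (C.homologyπ i z) = ψ (C.iCycles i z) := fun z => by
    have : C.homologyπ i ≫ F = C.iCycles i ≫ ModuleCat.ofHom ψ := by
      simp [F]
    exact congrArg (fun f => f.hom z) this
  have hsurj : Function.Surjective (C.homologyπ i) :=
    (ModuleCat.epi_iff_surjective _).1 inferInstance
  have hmono : Function.Injective (C.iCycles i) :=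
    (ModuleCat.mono_iff_injective _).1 inferInstance
  refine ⟨F.hom, ?_, fun h => ?_⟩
  · rw [← LinearMap.ker_eq_bot, LinearMap.ker_eq_bot']
    intro h hh
    obtain ⟨z, rfl⟩ := hsurj h
    rw [hF] at hh
    obtain ⟨y, hy⟩ := h₂ _ hh
    have hz : C.toCycles (i + 1) i y = z := hmono <| by
      rw [← hy]
      exact congrArg (fun f => f.hom y) (C.toCycles_i (i + 1) i)
    rw [← hz]
    exact congrArg (fun f => f.hom y) (C.toCycles_comp_homologyπ (i + 1) i)
  · obtain ⟨z, rfl⟩ := hsurj h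
    exact ⟨C.iCycles i z, congrArg (fun f => f.hom z) (C.iCycles_d i (i - 1)), hF z⟩

variable {K G : Type u} [CommRing K] [Group G]

/-- The identification `(K ⊗ B)_G → B_G`. -/
def Rep.trivialTensorCoinvariants (B : Rep.{u} K G) :
    ((Rep.trivial K G K).ρ.tprod B.ρ).Coinvariants →ₗ[K] B.ρ.Coinvariants :=
  Coinvariants.lift _ (Coinvariants.mk B.ρ ∘ₗ (TensorProduct.lid K B).toLinearMap) fun g => by
    ext x
    simp

/-- A linear map on the chains of a projective resolution of the trivial representation induces
an injection of the group homology. -/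
theorem groupHomology.exists_injective (R : ProjectiveResolution (Rep.trivial K G K)) (j : ℕ)
    {V : Type u} [AddCommGroup V] [Module K V] (N : Submodule K V)
    (φ : R.complex.X (j + 1) →ₗ[K] V) (hφ : ∀ g x, φ ((R.complex.X (j + 1)).ρ g x) = φ x)
    (h₁ : ∀ y, φ ((R.complex.d (j + 2) (j + 1)).hom y) ∈ N)
    (h₂ : ∀ x, φ x ∈ N → ∃ y, x - (R.complex.d (j + 2) (j + 1)).hom y ∈
      Coinvariants.ker (R.complex.X (j + 1)).ρ) :
    ∃ f : groupHomology (Rep.trivial K G K) (j + 1) →ₗ[K] V ⧸ N, Function.Injective f ∧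
      ∀ h, ∃ x, (R.complex.d (j + 1) j).hom x ∈ Coinvariants.ker (R.complex.X j).ρ ∧
        f h = N.mkQ (φ x) := by
  classical
  let C := R.complex.coinvariantsTensorObj (Rep.trivial K G K)
  let q : ∀ i, R.complex.X i →ₗ[K] C.X i := fun i =>
    Rep.coinvariantsTensorMk (Rep.trivial K G K) (R.complex.X i) (1 : K)
  have hq : ∀ i, Function.Surjective (q i) := fun i y => by
    obtain ⟨t, rfl⟩ := Coinvariants.mk_surjective _ y
    refine ⟨TensorProduct.lid K _ t, ?_⟩
    have : (1 : K) ⊗ₜ[K] (TensorProduct.lid K (R.complex.X i) t) = t :=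
      (TensorProduct.lid K _).symm_apply_apply t
    exact congrArg (Coinvariants.mk _) this
  have hqt : ∀ i x, Rep.trivialTensorCoinvariants (R.complex.X i) (q i x) =
      Coinvariants.mk _ x := fun i x => by
    change Coinvariants.mk _ (TensorProduct.lid K _ ((1 : K) ⊗ₜ x)) = _
    simp
  have hker : ∀ i x, q i x = 0 → x ∈ Coinvariants.ker (R.complex.X i).ρ := fun i x hx => by
    exact (Coinvariants.mk_eq_zero _).1 ((hqt i x).symm.trans
      ((congrArg (Rep.trivialTensorCoinvariants _) hx).trans (map_zero _)))
  have hker' : ∀ i, Coinvariants.ker (R.complex.X i).ρ ≤ LinearMap.ker (q i) := fun i => by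
    refine Submodule.span_le.2 ?_
    rintro - ⟨⟨g, x⟩, rfl⟩
    change q i ((R.complex.X i).ρ g x - x) = 0
    rw [map_sub, sub_eq_zero]
    exact Coinvariants.mk_self_apply ((Rep.trivial K G K).ρ.tprod (R.complex.X i).ρ) g
      ((1 : K) ⊗ₜ x)
  have hd : ∀ i k x, C.d i k (q i x) = q k ((R.complex.d i k).hom x) := fun i k x => rfl
  let φ' : (R.complex.X (j + 1)).ρ.Coinvariants →ₗ[K] V :=
    Coinvariants.lift _ φ fun g => LinearMap.ext (hφ g)
  let ψ : C.X (j + 1) →ₗ[K] V ⧸ N :=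
    N.mkQ ∘ₗ φ' ∘ₗ Rep.trivialTensorCoinvariants (R.complex.X (j + 1))
  have hψ : ∀ x, ψ (q _ x) = N.mkQ (φ x) := fun x => by
    change N.mkQ (φ' (Rep.trivialTensorCoinvariants _ (q _ x))) = _
    rw [hqt]; rfl
  obtain ⟨f, hf, hf'⟩ := HomologicalComplex.exists_injective_of_homology C (j + 1) ψ
    (fun y => by
      obtain ⟨y, rfl⟩ := hq _ y
      rw [hd, hψ, Submodule.mkQ_apply, Submodule.Quotient.mk_eq_zero]
      exact h₁ y)
    (fun x hx => by
      obtain ⟨x, rfl⟩ := hq _ x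
      rw [hψ, Submodule.mkQ_apply, Submodule.Quotient.mk_eq_zero] at hx
      obtain ⟨y, hy⟩ := h₂ x hx
      refine ⟨q _ y, ?_⟩
      rw [hd, eq_comm, ← sub_eq_zero, ← map_sub]
      exact hker' _ hy)
  let e := (groupHomologyIso (Rep.trivial K G K) (j + 1) R).toLinearEquiv
  refine ⟨f ∘ₗ e.toLinearMap, hf.comp e.injective, fun h => ?_⟩
  obtain ⟨x, hx, hx'⟩ := hf' (e h)
  obtain ⟨x, rfl⟩ := hq _ x
  exact ⟨x, hker _ _ hx, by rw [← hψ, ← hx']; rfl⟩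

end HomologyEmbedding

/-! ### Equivariant maps between free modules over group rings and finite quotients -/

namespace FreeModule

variable {K : Type*} [CommRing K] {ι κ : Type*} {Γ Q : Type*} [Group Γ] [Group Q]

variable (K ι) in
/-- Left translation on the free `K[Γ]`-module with basis `ι`. -/
def transl (g : Γ) : (ι × Γ →₀ K) →ₗ[K] (ι × Γ →₀ K) :=
  Finsupp.lmapDomain K K fun x => (x.1, g * x.2)

lemma transl_single (g : Γ) (b : ι) (x : Γ) (a : K) :
    transl K ι g (Finsupp.single (b, x) a) = Finsupp.single (b, g * x) a := by
  simp [transl]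

variable (K ι) in
/-- The map on free modules induced by a homomorphism of groups. -/
def proj (p : Γ →* Q) : (ι × Γ →₀ K) →ₗ[K] (ι × Q →₀ K) :=
  Finsupp.lmapDomain K K fun x => (x.1, p x.2)

lemma proj_single (p : Γ →* Q) (b : ι) (x : Γ) (a : K) :
    proj K ι p (Finsupp.single (b, x) a) = Finsupp.single (b, p x) a := by
  simp [proj]

lemma proj_transl (p : Γ →* Q) (g : Γ) (x : ι × Γ →₀ K) :
    proj K ι p (transl K ι g x) = transl K ι (p g) (proj K ι p x) := by
  have : proj K ι p ∘ₗ transl K ι g = transl K ι (p g) ∘ₗ proj K ι p := by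
    refine Finsupp.lhom_ext fun ⟨b, y⟩ a => ?_
    simp [transl_single, proj_single]
  exact LinearMap.congr_fun this x

/-- The map on finite quotients induced by an equivariant map. -/
def quotMap (p : Γ →* Q) (δ : (ι × Γ →₀ K) →ₗ[K] (κ × Γ →₀ K)) :
    (ι × Q →₀ K) →ₗ[K] (κ × Q →₀ K) :=
  Finsupp.linearCombination K fun x => transl K κ x.2 (proj K κ p (δ (Finsupp.single (x.1, 1) 1)))

lemma quotMap_single (p : Γ →* Q) (δ : (ι × Γ →₀ K) →ₗ[K] (κ × Γ →₀ K)) (b : ι) (x : Q) :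
    quotMap p δ (Finsupp.single (b, x) 1) =
      transl K κ x (proj K κ p (δ (Finsupp.single (b, 1) 1))) := by
  simp [quotMap]

lemma map_single_eq_transl {δ : (ι × Γ →₀ K) →ₗ[K] (κ × Γ →₀ K)}
    (hδ : ∀ g x, δ (transl K ι g x) = transl K κ g (δ x)) (b : ι) (g : Γ) :
    δ (Finsupp.single (b, g) 1) = transl K κ g (δ (Finsupp.single (b, 1) 1)) := by
  rw [← hδ, transl_single, mul_one]

/-- Equivariance makes `δ` descend along `p`, so that cycles over `Γ` and over `Q` can be compared.
-/
lemma quotMap_proj (p : Γ →* Q) {δ : (ι × Γ →₀ K) →ₗ[K] (κ × Γ →₀ K)}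
    (hδ : ∀ g x, δ (transl K ι g x) = transl K κ g (δ x)) (x : ι × Γ →₀ K) :
    quotMap p δ (proj K ι p x) = proj K κ p (δ x) := by
  have : quotMap p δ ∘ₗ proj K ι p = proj K κ p ∘ₗ δ := by
    refine Finsupp.lhom_ext' fun ⟨b, y⟩ => LinearMap.ext_ring ?_
    change quotMap p δ (proj K ι p (Finsupp.single (b, y) 1)) =
      proj K κ p (δ (Finsupp.single (b, y) 1))
    rw [proj_single, quotMap_single, map_single_eq_transl hδ b y, proj_transl]
  exact LinearMap.congr_fun this x

lemma support_transl_subset (g : Γ) (x : ι × Γ →₀ K) {y : ι × Γ}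
    (hy : y ∈ (transl K ι g x).support) : (y.1, g⁻¹ * y.2) ∈ x.support := by
  classical
  obtain ⟨z, hz, rfl⟩ := Finset.mem_image.1 (Finsupp.mapDomain_support hy)
  simpa using hz

lemma support_proj_subset (p : Γ →* Q) (x : ι × Γ →₀ K) {y : ι × Q}
    (hy : y ∈ (proj K ι p x).support) : ∃ g, (y.1, g) ∈ x.support ∧ p g = y.2 := by
  classical
  obtain ⟨z, hz, rfl⟩ := Finset.mem_image.1 (Finsupp.mapDomain_support hy)
  exact ⟨z.2, hz, rfl⟩

/-- If the finite group `Q` is partitioned into pieces `a ⁻¹' {q}` that lift to translates of `F`,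
then a chain supported away from the boundaries of the pieces whose image is a cycle over `Q` lifts
to a cycle. -/
theorem mem_map_ker_of_partition [Finite Q] (p : Γ →* Q) (hp : Function.Surjective p)
    {δ : (ι × Γ →₀ K) →ₗ[K] (κ × Γ →₀ K)}
    (hδ : ∀ g x, δ (transl K ι g x) = transl K κ g (δ x))
    {S F : Set Γ} (hS : ∀ b, ∀ y ∈ (δ (Finsupp.single (b, 1) 1)).support, y.2 ∈ S)
    (hinj : ∀ f ∈ F, ∀ s ∈ S, ∀ f' ∈ F, ∀ s' ∈ S, p (f * s) = p (f' * s') → f * s = f' * s')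
    (a : Q → Q) (ha : ∀ x, ∃ f ∈ F, x = a x * p f) {e : ι × Q →₀ K}
    (he : e ∈ Finsupp.supported K K {y : ι × Q | ∀ s ∈ S, a (y.2 * p s) = a y.2})
    (hd : quotMap p δ e = 0) : e ∈ (LinearMap.ker δ).map (proj K ι p) := by
  classical
  cases nonempty_fintype Q
  -- The differential moves a basis vector only by elements of `p S`, which keep points of the
  -- support of `e` in their piece. It therefore commutes with restriction to a piece, and each
  -- restriction of `e` is a cycle.
  have hfilter : ∀ q, quotMap p δ (e.filter fun y => a y.2 = q) =
      (quotMap p δ e).filter fun y => a y.2 = q := by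
    intro q
    clear hd
    rw [Finsupp.supported_eq_span_single] at he
    induction he using Submodule.span_induction with
    | mem e he =>
      obtain ⟨⟨b, x⟩, hx, rfl⟩ := he
      simp only [Set.mem_ofPred_eq] at hx
      have hsupp : ∀ y ∈ (quotMap p δ (Finsupp.single (b, x) 1)).support, a y.2 = a x := by
        intro y hy
        rw [quotMap_single] at hy
        obtain ⟨g, hg, hg'⟩ := support_proj_subset p _ (support_transl_subset _ _ hy)
        have := hx g (hS b _ hg)
        simp only at hg'
        rwa [hg', mul_inv_cancel_left] at this
      change quotMap p δ ((Finsupp.single (b, x) (1 : K)).filter fun y => a y.2 = q) =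
        (quotMap p δ (Finsupp.single (b, x) 1)).filter fun y => a y.2 = q
      by_cases h : a x = q
      · rw [Finsupp.filter_single_of_pos (fun y : ι × Q => a y.2 = q) h,
          eq_comm, Finsupp.filter_eq_self_iff]
        intro y hy
        rw [hsupp y (Finsupp.mem_support_iff.2 hy), h]
      · rw [Finsupp.filter_single_of_neg (fun y : ι × Q => a y.2 = q) h, map_zero,
          eq_comm, Finsupp.filter_eq_zero_iff]
        intro y hy
        by_contra h0
        exact h (by rw [← hy, hsupp y (Finsupp.mem_support_iff.2 h0)])
    | zero => rw [Finsupp.filter_zero, map_zero, Finsupp.filter_zero]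
    | add x y _ _ hx hy => rw [Finsupp.filter_add, map_add, map_add, Finsupp.filter_add, hx, hy]
    | smul c x _ hx => rw [Finsupp.filter_smul, map_smul, map_smul, Finsupp.filter_smul, hx]
  have hsum : e = ∑ q, e.filter fun y => a y.2 = q := by
    ext y
    rw [Finsupp.finsetSum_apply]
    simp [Finsupp.filter_apply]
  rw [hsum]
  refine Submodule.sum_mem _ fun q _ => ?_
  choose f hfF hf using ha
  obtain ⟨q', rfl⟩ := hp q
  -- The piece over `p q'` lies in `p (q' * F)`, so it lifts into the translate `q' * F`.
  let l : ι × Q → ι × Γ := fun y => (y.1, q' * f y.2)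
  let z : ι × Γ →₀ K := (e.filter fun y => a y.2 = p q').mapDomain l
  have hz : proj K ι p z = e.filter fun y => a y.2 = p q' := by
    change (Finsupp.mapDomain l _).mapDomain _ = _
    rw [← Finsupp.mapDomain_comp]
    conv_rhs => rw [← Finsupp.mapDomain_id (v := e.filter fun y => a y.2 = p q')]
    refine Finsupp.mapDomain_congr fun y hy => ?_
    rw [Finsupp.support_filter, Finset.mem_filter] at hy
    refine Prod.ext rfl ?_
    simp only [Function.comp, l, map_mul, id]
    rw [← hy.2, ← hf]
  refine ⟨z, ?_, hz⟩
  have hzs : z ∈ Finsupp.supported K K {y : ι × Γ | ∃ g ∈ F, y.2 = q' * g} := by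
    intro y hy
    obtain ⟨w, hw, rfl⟩ := Finset.mem_image.1 (Finsupp.mapDomain_support hy)
    exact ⟨f w.2, hfF _, rfl⟩
  have hδz : δ z ∈ Finsupp.supported K K {y : κ × Γ | ∃ g ∈ F, ∃ s ∈ S, y.2 = q' * (g * s)} := by
    have : Finsupp.supported K K {y : ι × Γ | ∃ g ∈ F, y.2 = q' * g} ≤
        (Finsupp.supported K K {y : κ × Γ | ∃ g ∈ F, ∃ s ∈ S, y.2 = q' * (g * s)}).comap δ := by
      rw [Finsupp.supported_eq_span_single, Submodule.span_le]
      rintro - ⟨⟨b, x⟩, ⟨g, hg, hx⟩, rfl⟩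
      simp only at hx
      rw [SetLike.mem_coe, Submodule.mem_comap, map_single_eq_transl hδ]
      intro y hy
      exact ⟨g, hg, _, hS b _ (support_transl_subset _ _ hy), by simp [hx, mul_assoc]⟩
    exact this hzs
  have hpz : proj K κ p (δ z) = 0 := by
    rw [← quotMap_proj p hδ, hz, hfilter, hd, Finsupp.filter_zero]
  -- `δ z` is supported in `q' * F * S`, where `p` is injective by `hinj`; its image vanishes, hence
  -- so does `δ z`.
  refine Finsupp.mapDomain_injOn _ ?_ hδz (by simp) (hpz.trans Finsupp.mapDomain_zero.symm)
  rintro ⟨c, x⟩ ⟨g, hg, s, hs, hx⟩ ⟨c', x'⟩ ⟨g', hg', s', hs', hx'⟩ h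
  simp only [Prod.mk.injEq] at h hx hx'
  obtain ⟨rfl, h⟩ := h
  rw [hx, hx', map_mul p q' (g * s), map_mul p q' (g' * s'), mul_right_inj] at h
  rw [hx, hx', hinj g hg s hs g' hg' s' hs' h]

end FreeModule

/-! ### Partitions of finite groups into subsets of translates with small boundary -/

namespace RandomOrder

variable {Q : Type*} [Fintype Q]

/-- `u` is the minimum of `U` with respect to the order defined by `σ`. -/
def IsMin (σ : Q ≃ Fin (Fintype.card Q)) (U : Finset Q) (u : Q) : Prop :=
  u ∈ U ∧ ∀ v ∈ U, σ u ≤ σ v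

lemma IsMin.eq {σ : Q ≃ Fin (Fintype.card Q)} {U : Finset Q} {u v : Q} (hu : IsMin σ U u)
    (hv : IsMin σ U v) : u = v :=
  σ.injective (le_antisymm (hu.2 v hv.1) (hv.2 u hu.1))

lemma exists_isMin (σ : Q ≃ Fin (Fintype.card Q)) {U : Finset Q} (hU : U.Nonempty) :
    ∃ u, IsMin σ U u :=
  U.exists_min_image σ hU

variable [DecidableEq Q]

-- Composing an order with the transposition of `u` and `v` turns orders with minimum `u` into
-- orders with minimum `v`.
open Classical in
lemma card_isMin_le (U : Finset Q) {u v : Q} (hu : u ∈ U) (hv : v ∈ U) :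
    (Finset.univ.filter fun σ => IsMin σ U u).card ≤
      (Finset.univ.filter fun σ => IsMin σ U v).card := by
  refine Finset.card_le_card_of_injOn (fun σ => (Equiv.swap u v).trans σ) ?_ ?_
  · intro σ hσ
    have hσ' : IsMin σ U u := (Finset.mem_filter.1 hσ).2
    refine Finset.mem_filter.2 ⟨Finset.mem_univ _, hv, fun w hw => ?_⟩
    simp only [Equiv.trans_apply, Equiv.swap_apply_right]
    refine hσ'.2 _ ?_
    rw [Equiv.swap_apply_def]
    split_ifs <;> assumption
  · intro σ _ τ _ h
    ext x
    have := Equiv.congr_fun h (Equiv.swap u v x)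
    simp at this
    rw [this]

open Classical in
/-- The minimum of a finite set with respect to a random order is uniformly distributed. -/
lemma card_exists_isMin (U Δ : Finset Q) (hΔ : Δ ⊆ U) :
    U.card * (Finset.univ.filter fun σ => ∃ u ∈ Δ, IsMin σ U u).card ≤
      Δ.card * Fintype.card (Q ≃ Fin (Fintype.card Q)) := by
  have h1 : (Finset.univ.filter fun σ => ∃ u ∈ Δ, IsMin σ U u).card ≤
      ∑ u ∈ Δ, (Finset.univ.filter fun σ => IsMin σ U u).card := by
    refine (Finset.card_le_card fun σ hσ => ?_).trans Finset.card_biUnion_le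
    simpa using hσ
  have h2 : ∑ u ∈ U, (Finset.univ.filter fun σ => IsMin σ U u).card ≤
      Fintype.card (Q ≃ Fin (Fintype.card Q)) := by
    rw [← Finset.card_biUnion]
    · exact Finset.card_le_univ _
    · intro u _ v _ huv
      refine Finset.disjoint_left.2 fun σ h h' => huv ?_
      exact IsMin.eq (Finset.mem_filter.1 h).2 (Finset.mem_filter.1 h').2
  calc U.card * (Finset.univ.filter fun σ => ∃ u ∈ Δ, IsMin σ U u).card
      ≤ U.card * ∑ u ∈ Δ, (Finset.univ.filter fun σ => IsMin σ U u).card :=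
        Nat.mul_le_mul_left _ h1
    _ = ∑ u ∈ Δ, ∑ v ∈ U, (Finset.univ.filter fun σ => IsMin σ U u).card := by
        simp [Finset.mul_sum]
    _ ≤ ∑ u ∈ Δ, ∑ v ∈ U, (Finset.univ.filter fun σ => IsMin σ U v).card :=
        Finset.sum_le_sum fun u hu => Finset.sum_le_sum fun v hv =>
          card_isMin_le U (hΔ hu) hv
    _ ≤ ∑ u ∈ Δ, Fintype.card (Q ≃ Fin (Fintype.card Q)) := Finset.sum_le_sum fun _ _ => h2
    _ = _ := by simp

open Classical in
/-- A finite group `Q` can be partitioned into subsets of left translates of `F`, such that the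
boundaries of the pieces are controlled by the boundary of `F`. -/
theorem exists_partition [Group Q] {F : Finset Q} (hF : F.Nonempty) (S : Finset Q) (m : ℕ)
    (hm : ∀ s ∈ S, (F.filter fun f => f * s ∉ F).card ≤ m) :
    ∃ a : Q → Q, (∀ x, ∃ f ∈ F, x = a x * f) ∧
      F.card * (Finset.univ.filter fun x => ∃ s ∈ S, a (x * s) ≠ a x).card ≤
        2 * m * S.card * Fintype.card Q := by
  -- `X x` is the set of `u` with `x ∈ u F`; the piece of `x` is named by the least such `u`.
  let X : Q → Finset Q := fun x => F.image fun f => x * f⁻¹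
  have hXcard : ∀ x, (X x).card = F.card := fun x =>
    Finset.card_image_of_injective _ fun f f' h => by simpa using h
  have hXne : ∀ x, (X x).Nonempty := fun x => hF.image _
  choose a ha using fun (σ : Q ≃ Fin (Fintype.card Q)) x => exists_isMin σ (hXne x)
  let p := Fintype.card (Q ≃ Fin (Fintype.card Q))
  have hpair : ∀ x, ∀ s ∈ S,
      F.card * (Finset.univ.filter fun σ => a σ (x * s) ≠ a σ x).card ≤ 2 * m * p := by
    intro x s hs
    let U := X x ∪ X (x * s)
    let Δ := (X x \ X (x * s)) ∪ (X (x * s) \ X x)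
    have hΔ : Δ ⊆ U := by
      intro y hy
      simp only [Δ, U, Finset.mem_union, Finset.mem_sdiff] at hy ⊢
      tauto
    have hd : (X x \ X (x * s)).card ≤ m := by
      refine le_trans ?_ (hm s hs)
      refine (Finset.card_le_card (t := (F.filter fun f => f * s ∉ F).image fun f => x * f⁻¹)
        fun y hy => ?_).trans Finset.card_image_le
      obtain ⟨hy1, hy2⟩ := Finset.mem_sdiff.1 hy
      obtain ⟨f, hf, rfl⟩ := Finset.mem_image.1 hy1
      refine Finset.mem_image.2 ⟨f, Finset.mem_filter.2 ⟨hf, fun hfs => hy2 ?_⟩, rfl⟩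
      exact Finset.mem_image.2 ⟨f * s, hfs, by group⟩
    have hd' : (X (x * s) \ X x).card ≤ m := by
      rwa [Finset.card_sdiff_comm ((hXcard _).trans (hXcard _).symm)]
    have hΔcard : Δ.card ≤ 2 * m := (Finset.card_union_le _ _).trans (by omega)
    have hU : F.card ≤ U.card := (hXcard x).symm.le.trans
      (Finset.card_le_card Finset.subset_union_left)
    -- If the minimum of `U` lies in both `X x` and `X (x * s)`, it is the minimum of each, and the
    -- two labels agree.
    have hsub : (Finset.univ.filter fun σ => a σ (x * s) ≠ a σ x) ⊆
        Finset.univ.filter fun σ => ∃ u ∈ Δ, IsMin σ U u := by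
      intro σ hσ
      have hne := (Finset.mem_filter.1 hσ).2
      obtain ⟨u, hu⟩ := exists_isMin σ (U := U) ((hXne x).mono Finset.subset_union_left)
      refine Finset.mem_filter.2 ⟨Finset.mem_univ _, u, ?_, hu⟩
      by_contra hnot
      have hboth : u ∈ X x ∧ u ∈ X (x * s) := by
        have := hu.1
        simp only [Δ, U, Finset.mem_union, Finset.mem_sdiff] at hnot this
        tauto
      have e1 : a σ x = u := (ha σ x).eq
        ⟨hboth.1, fun v hv => hu.2 v (Finset.mem_union_left _ hv)⟩
      have e2 : a σ (x * s) = u := (ha σ (x * s)).eq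
        ⟨hboth.2, fun v hv => hu.2 v (Finset.mem_union_right _ hv)⟩
      exact hne (e2.trans e1.symm)
    calc _ ≤ U.card * (Finset.univ.filter fun σ => ∃ u ∈ Δ, IsMin σ U u).card :=
          Nat.mul_le_mul hU (Finset.card_le_card hsub)
      _ ≤ Δ.card * p := card_exists_isMin U Δ hΔ
      _ ≤ 2 * m * p := Nat.mul_le_mul_right _ hΔcard
  have hsum : ∑ σ : Q ≃ Fin (Fintype.card Q),
      F.card * (Finset.univ.filter fun x => ∃ s ∈ S, a σ (x * s) ≠ a σ x).card ≤
        ∑ σ : Q ≃ Fin (Fintype.card Q), 2 * m * S.card * Fintype.card Q := by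
    have h1 : ∀ σ, (Finset.univ.filter fun x => ∃ s ∈ S, a σ (x * s) ≠ a σ x).card ≤
        ∑ x, ∑ s ∈ S, if a σ (x * s) ≠ a σ x then 1 else 0 := fun σ => by
      rw [Finset.card_filter]
      refine Finset.sum_le_sum fun x _ => ?_
      split_ifs with h
      · obtain ⟨s, hs, hne⟩ := h
        refine le_trans ?_ (Finset.single_le_sum
          (f := fun s => if a σ (x * s) ≠ a σ x then 1 else 0) (fun _ _ => Nat.zero_le _) hs)
        simp [hne]
      · exact Nat.zero_le _
    calc _ ≤ ∑ σ, F.card * ∑ x, ∑ s ∈ S, if a σ (x * s) ≠ a σ x then 1 else 0 :=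
          Finset.sum_le_sum fun σ _ => Nat.mul_le_mul_left _ (h1 σ)
      _ = ∑ x, ∑ s ∈ S, F.card * (Finset.univ.filter fun σ => a σ (x * s) ≠ a σ x).card := by
          simp_rw [Finset.card_filter, ← Finset.mul_sum]
          congr 1
          rw [Finset.sum_comm]
          refine Finset.sum_congr rfl fun x _ => Finset.sum_comm
      _ ≤ ∑ x : Q, ∑ s ∈ S, 2 * m * p :=
          Finset.sum_le_sum fun x _ => Finset.sum_le_sum fun s hs => hpair x s hs
      _ = _ := by
          simp only [Finset.sum_const, smul_eq_mul, Finset.card_univ, p]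
          ring
  -- Some order does at least as well as the average.
  obtain ⟨σ, -, hσ⟩ := Finset.exists_le_of_sum_le
    (⟨Fintype.equivFin Q, Finset.mem_univ _⟩ : Finset.univ.Nonempty) hsum
  refine ⟨a σ, fun x => ?_, hσ⟩
  obtain ⟨f, hf, hfx⟩ := Finset.mem_image.1 (ha σ x).1
  exact ⟨f, hf, by rw [← hfx]; group⟩

end RandomOrder

/-! ### Torsion in finitely presented abelian groups -/

/-- Expanding the product gives a sum over all maps `B → B`, and the Leibniz formula uses only the
permutations among them. -/
lemma Matrix.natAbs_det_le {B : Type*} [Fintype B] [DecidableEq B] (A : Matrix B B ℤ) :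
    A.det.natAbs ≤ ∏ i, ∑ j, (A i j).natAbs := by
  classical
  rw [← Matrix.det_transpose, Matrix.det_apply', Finset.prod_univ_sum]
  refine (Int.natAbs_sum_le _ _).trans ?_
  have : ∀ σ : Equiv.Perm B, ((Equiv.Perm.sign σ : ℤ) * ∏ i, A.transpose (σ i) i).natAbs =
      ∏ i, (A i (σ i)).natAbs := fun σ => by
    rw [Int.natAbs_mul, Int.units_natAbs, one_mul]
    exact map_prod Int.natAbsHom _ _
  refine (Finset.sum_congr rfl fun σ _ => this σ).trans_le ?_
  rw [← Finset.sum_image (s := Finset.univ) (g := fun σ : Equiv.Perm B => (σ : B → B))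
    (f := fun p : B → B => ∏ i, (A i (p i)).natAbs) (fun _ _ _ _ h => DFunLike.coe_injective h)]
  refine Finset.sum_le_sum_of_subset fun p _ => ?_
  simp

/-- A finite index lattice spanned by vectors of small norm has small index. -/
lemma card_le_pow_of_torsion_generators {M B : Type*} [AddCommGroup M] [Fintype B] [DecidableEq B]
    (ψ : (B → ℤ) →ₗ[ℤ] M) (hψ : Function.Surjective ψ) (R : Set (B → ℤ)) (c : ℕ)
    (hR : ∀ r ∈ R, ∑ b, (r b).natAbs ≤ c) (hker : LinearMap.ker ψ = Submodule.span ℤ R)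
    (htor : ∀ b, ∃ n : ℤ, n ≠ 0 ∧ n • ψ (Pi.single b 1) = 0) :
    Finite M ∧ Nat.card M ≤ c ^ Fintype.card B := by
  let C : (B → ℤ) →ₗ[ℤ] (B → ℚ) := (Int.castAddHom ℚ).toIntLinearMap.compLeft B
  have hspan : Submodule.span ℚ (C '' R) = ⊤ := by
    rw [eq_top_iff, ← (Pi.basisFun ℚ B).span_eq, Submodule.span_le]
    rintro - ⟨b, rfl⟩
    obtain ⟨n, hn, hnb⟩ := htor b
    have h1 : n • (Pi.single b 1 : B → ℤ) ∈ Submodule.span ℤ R := by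
      rw [← hker, LinearMap.mem_ker, map_smul, hnb]
    have h2 : C (n • (Pi.single b 1 : B → ℤ)) ∈ Submodule.span ℚ (C '' R) := by
      have : Submodule.span ℤ R ≤
          ((Submodule.span ℚ (C '' R)).restrictScalars ℤ).comap C :=
        Submodule.span_le.2 fun r hr => Submodule.subset_span ⟨r, hr, rfl⟩
      exact this h1
    have h3 : C (n • (Pi.single b 1 : B → ℤ)) = (n : ℚ) • Pi.basisFun ℚ B b := by
      ext x
      simp [C, Pi.single_apply]
    rw [h3] at h2
    have := Submodule.smul_mem _ ((n : ℚ)⁻¹) h2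
    rwa [smul_smul, inv_mul_cancel₀ (Int.cast_ne_zero.2 hn), one_smul] at this
  -- All generators are torsion, so the relations span rationally. A rational basis chosen among
  -- them spans a sublattice `L` of finite index `|det A|`, and `M` is a quotient of `(B → ℤ) ⧸ L`.
  obtain ⟨t, htR, htspan, htli⟩ := exists_linearIndependent ℚ (C '' R)
  let bt : Module.Basis t ℚ (B → ℚ) := Module.Basis.mk htli (by
    rw [Subtype.range_coe, htspan, hspan])
  let e : B ≃ t := (Pi.basisFun ℚ B).indexEquiv bt
  have hr : ∀ b, ∃ r ∈ R, C r = e b := fun b => htR (e b).2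
  choose r hrR hr using hr
  let A : Matrix B B ℤ := Matrix.of r
  have hdet : A.det ≠ 0 := by
    intro h0
    have hli : LinearIndependent ℚ (fun b => C (r b)) := by
      rw [show (fun b => C (r b)) = (fun x : t => (x : B → ℚ)) ∘ e from funext hr]
      exact htli.comp e e.injective
    have : IsUnit (A.map (Int.castRingHom ℚ)) := Matrix.linearIndependent_rows_iff_isUnit.1 hli
    rw [Matrix.isUnit_iff_isUnit_det, ← RingHom.mapMatrix_apply, ← RingHom.map_det, h0] at this
    simp at this
  have hli : LinearIndependent ℤ r := Matrix.linearIndependent_rows_of_det_ne_zero hdet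
  let L := Submodule.span ℤ (Set.range r)
  have hcard : A.det.natAbs = Nat.card ((B → ℤ) ⧸ L) := by
    rw [← Submodule.natAbs_det_basis_change (Pi.basisFun ℤ B) L (Module.Basis.span hli),
      Pi.basisFun_det]
    congr 2
    ext b x
    exact congrFun (congrArg Subtype.val (Module.Basis.span_apply hli b).symm) x
  have hle : L ≤ LinearMap.ker ψ := by
    rw [hker]
    exact Submodule.span_mono (Set.range_subset_iff.2 hrR)
  have hsurj : Function.Surjective (L.liftQ ψ hle) := fun m => by
    obtain ⟨x, rfl⟩ := hψ m
    exact ⟨L.mkQ x, rfl⟩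
  have hfin : Finite ((B → ℤ) ⧸ L) := Nat.finite_of_card_ne_zero (by
    rw [← hcard]; exact Int.natAbs_ne_zero.2 hdet)
  refine ⟨Finite.of_surjective _ hsurj, ?_⟩
  calc Nat.card M ≤ Nat.card ((B → ℤ) ⧸ L) := Nat.card_le_card_of_surjective _ hsurj
    _ = A.det.natAbs := hcard.symm
    _ ≤ ∏ i, ∑ j, (A i j).natAbs := A.natAbs_det_le
    _ ≤ ∏ _i : B, c := Finset.prod_le_prod' fun i _ => hR _ (hrR i)
    _ = c ^ Fintype.card B := by simp

/-- An abelian group generated by finitely many elements, subject to relations of norm at most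
`c`, has at most `c ^ d` torsion elements, where `d` is the number of generators. -/
theorem card_torsion_le_pow {c : ℕ} (hc : 1 ≤ c) {M B : Type*} [AddCommGroup M] [Fintype B]
    (ψ : (B → ℤ) →ₗ[ℤ] M) (hψ : Function.Surjective ψ) (R : Set (B → ℤ))
    (hR : ∀ r ∈ R, ∑ b, (r b).natAbs ≤ c) (hker : LinearMap.ker ψ = Submodule.span ℤ R) :
    Finite (AddCommGroup.torsion M) ∧
      Nat.card (AddCommGroup.torsion M) ≤ c ^ Fintype.card B := by
  classical
  induction hn : Fintype.card B generalizing M B with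
  | zero =>
    have : IsEmpty B := Fintype.card_eq_zero_iff.1 hn
    have : Subsingleton M := hψ.subsingleton
    exact ⟨inferInstance, by simp⟩
  | succ n ih =>
    by_cases htor : ∀ b, ∃ n : ℤ, n ≠ 0 ∧ n • ψ (Pi.single b 1) = 0
    · obtain ⟨hfin, hcard⟩ := card_le_pow_of_torsion_generators ψ hψ R c hR hker htor
      exact ⟨inferInstance, hn ▸ (Nat.card_le_card_of_injective _ Subtype.val_injective).trans
        hcard⟩
    push Not at htor
    obtain ⟨b, hb⟩ := htor
    -- A generator of infinite order is killed. This removes one coordinate, which does not increase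
    -- the norms of the relations.
    let N : Submodule ℤ M := Submodule.span ℤ {ψ (Pi.single b 1)}
    let res : (B → ℤ) →ₗ[ℤ] ({x // x ≠ b} → ℤ) := LinearMap.funLeft ℤ ℤ Subtype.val
    let ext : ({x // x ≠ b} → ℤ) →ₗ[ℤ] (B → ℤ) :=
      { toFun := fun f x => if h : x ≠ b then f ⟨x, h⟩ else 0
        map_add' := fun f g => by ext x; by_cases h : x = b <;> simp [h]
        map_smul' := fun m f => by ext x; by_cases h : x = b <;> simp [h] }
    have hres : ∀ f, res (ext f) = f := fun f => by
      ext x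
      simp [res, ext, LinearMap.funLeft_apply, x.2]
    have hext : ∀ f, f = ext (res f) + f b • (Pi.single b 1 : B → ℤ) := fun f => by
      ext x
      by_cases h : x = b
      · subst h; simp [ext]
      · simp [ext, res, LinearMap.funLeft_apply, h]
    let ψ' : ({x // x ≠ b} → ℤ) →ₗ[ℤ] M ⧸ N := N.mkQ ∘ₗ ψ ∘ₗ ext
    have hψres : ∀ f, ψ' (res f) = N.mkQ (ψ f) := fun f => by
      conv_rhs => rw [hext f]
      rw [map_add, map_add, map_smul]
      have : N.mkQ (f b • ψ (Pi.single b 1)) = 0 :=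
        (Submodule.Quotient.mk_eq_zero _).2
          (Submodule.smul_mem _ _ (Submodule.mem_span_singleton_self _))
      rw [this, add_zero]
      rfl
    have hres0 : res (Pi.single b 1) = 0 := by
      ext x
      simp [res, LinearMap.funLeft_apply, x.2]
    obtain ⟨hfin, hcard⟩ := ih ψ' (fun m => by
        obtain ⟨m, rfl⟩ := N.mkQ_surjective m
        obtain ⟨f, rfl⟩ := hψ m
        exact ⟨res f, hψres f⟩) (res '' R) (by
        rintro - ⟨r, hr, rfl⟩
        refine le_trans ?_ (hR r hr)
        calc ∑ x : {x // x ≠ b}, (r x).natAbs = ∑ x ∈ Finset.univ.filter (· ≠ b), (r x).natAbs :=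
              (Finset.sum_subtype (Finset.univ.filter (· ≠ b)) (fun x => by simp)
                fun x => (r x).natAbs).symm
          _ ≤ _ := Finset.sum_le_sum_of_subset (Finset.filter_subset _ _)) (by
        rw [← Submodule.map_span, ← hker]
        apply le_antisymm
        · intro f hf
          have h1 : ψ (ext f) ∈ N := (Submodule.Quotient.mk_eq_zero _).1 hf
          obtain ⟨m, hm⟩ := Submodule.mem_span_singleton.1 h1
          refine ⟨ext f - m • Pi.single b 1, ?_, ?_⟩
          · rw [SetLike.mem_coe, LinearMap.mem_ker, map_sub, map_smul, hm, sub_self]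
          · rw [map_sub, map_smul, hres0, hres, smul_zero, sub_zero]
        · rintro - ⟨f, hf, rfl⟩
          rw [LinearMap.mem_ker, hψres, (hf : ψ f = 0), map_zero])
      (by
        have h := Fintype.card_subtype_compl (fun x : B => x = b)
        rw [Fintype.card_subtype_eq, hn] at h
        exact h)
    let τ : AddCommGroup.torsion M → AddCommGroup.torsion (M ⧸ N) := fun x =>
      ⟨N.mkQ x, by
        have hx : IsOfFinAddOrder (x : M) := x.2
        exact (N.mkQ : M →ₗ[ℤ] M ⧸ N).toAddMonoidHom.isOfFinAddOrder hx⟩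
    -- `N` is infinite cyclic, so it contains no nonzero torsion element.
    have hτ : Function.Injective τ := by
      intro x y hxy
      have h1 : (x - y : M) ∈ N := by
        rw [← Submodule.Quotient.mk_eq_zero, Submodule.Quotient.mk_sub, sub_eq_zero]
        exact congrArg Subtype.val hxy
      obtain ⟨m, hm⟩ := Submodule.mem_span_singleton.1 h1
      have h2 : IsOfFinAddOrder (x - y : M) := (x - y).2
      obtain ⟨k, hk, hk'⟩ := isOfFinAddOrder_iff_nsmul_eq_zero.1 h2
      by_cases hm0 : m = 0
      · rw [hm0, zero_smul] at hm
        exact Subtype.ext (sub_eq_zero.1 hm.symm)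
      · refine absurd ?_ (hb (k * m) (mul_ne_zero (by exact_mod_cast hk.ne') hm0))
        rw [mul_smul, hm, natCast_zsmul, hk']
    exact ⟨Finite.of_injective τ hτ, (Nat.card_le_card_of_injective τ hτ).trans
      (hcard.trans (Nat.pow_le_pow_right hc (Nat.le_succ n)))⟩

/-! ### Coordinates on base changes of finitely generated projective modules -/

namespace GroupRingBaseChange

open FreeModule Representation

variable {Γ : Type u} [Group Γ] (K : Type (max u v)) [CommRing K]

section Coordinates

variable {M : Type u} [AddCommGroup M] [Module (MonoidAlgebra ℤ Γ) M] {I : Type*}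
  (i : M →ₗ[MonoidAlgebra ℤ Γ] (I →₀ MonoidAlgebra ℤ Γ))
  (π : (I →₀ MonoidAlgebra ℤ Γ) →ₗ[MonoidAlgebra ℤ Γ] M)

/-- The coordinates of an element of a free module with respect to the integral basis. -/
def coordHom : (I →₀ MonoidAlgebra ℤ Γ) →+ (I × Γ →₀ K) :=
  liftBasis fun b γ => Finsupp.single (b, γ) 1

lemma coordHom_smul (g : Γ) (z : I →₀ MonoidAlgebra ℤ Γ) :
    coordHom K (MonoidAlgebra.single g (1 : ℤ) • z) = transl K I g (coordHom K z) := by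
  have : (coordHom K).comp (DistribSMul.toAddMonoidHom _ (MonoidAlgebra.single g (1 : ℤ))) =
      (transl K I g).toAddMonoidHom.comp (coordHom K) := by
    refine addHom_ext_basis fun b γ => ?_
    simp only [AddMonoidHom.comp_apply, DistribSMul.toAddMonoidHom_apply, Finsupp.smul_single,
      smul_eq_mul, MonoidAlgebra.single_mul_single, one_mul, coordHom, liftBasis_single, one_smul,
      LinearMap.toAddMonoidHom_coe, transl_single]
  exact DFunLike.congr_fun this z

/-- The coordinate map on `K ⊗ M` obtained from a map of `M` to a free module. -/
def coord : K ⊗[ℤ] M →ₗ[K] (I × Γ →₀ K) :=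
  LinearMap.liftBaseChange K ((coordHom K).comp i.toAddMonoidHom).toIntLinearMap

lemma coord_tmul (a : K) (m : M) : coord K i (a ⊗ₜ m) = a • coordHom K (i m) := rfl

/-- The map to `K ⊗ M` obtained from a map of a free module to `M`. -/
def ofCoord : (I × Γ →₀ K) →ₗ[K] K ⊗[ℤ] M :=
  Finsupp.linearCombination K fun x =>
    (1 : K) ⊗ₜ π (Finsupp.single x.1 (MonoidAlgebra.single x.2 1))

lemma ofCoord_single (b : I) (γ : Γ) :
    ofCoord K π (Finsupp.single (b, γ) 1) =
      (1 : K) ⊗ₜ π (Finsupp.single b (MonoidAlgebra.single γ 1)) := by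
  simp [ofCoord]

lemma ofCoord_coordHom (z : I →₀ MonoidAlgebra ℤ Γ) :
    ofCoord K π (coordHom K z) = (1 : K) ⊗ₜ π z := by
  have : (ofCoord K π).toAddMonoidHom.comp (coordHom K) =
      ((TensorProduct.mk ℤ K M 1).toAddMonoidHom).comp π.toAddMonoidHom := by
    refine addHom_ext_basis fun b γ => ?_
    simp only [AddMonoidHom.comp_apply, coordHom, liftBasis_single, one_smul,
      LinearMap.toAddMonoidHom_coe, ofCoord_single]
    rfl
  exact DFunLike.congr_fun this z

variable {i π} in
lemma ofCoord_coord (h : ∀ m, π (i m) = m) (x : K ⊗[ℤ] M) : ofCoord K π (coord K i x) = x := by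
  have : ofCoord K π ∘ₗ coord K i = LinearMap.id := by
    refine TensorProduct.AlgebraTensorModule.ext fun a m => ?_
    rw [LinearMap.comp_apply, coord_tmul, map_smul, ofCoord_coordHom, h,
      TensorProduct.smul_tmul', smul_eq_mul, mul_one]
    rfl
  exact LinearMap.congr_fun this x

variable (M) in
/-- The action of a group element on `K ⊗ M`. -/
abbrev actK (g : Γ) : K ⊗[ℤ] M →ₗ[K] K ⊗[ℤ] M := (act M g).baseChange K

lemma coord_act (g : Γ) (x : K ⊗[ℤ] M) : coord K i (actK K M g x) = transl K I g (coord K i x) := by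
  have : coord K i ∘ₗ actK K M g = transl K I g ∘ₗ coord K i := by
    refine TensorProduct.AlgebraTensorModule.ext fun a m => ?_
    rw [LinearMap.comp_apply, LinearMap.comp_apply, LinearMap.baseChange_tmul, coord_tmul,
      coord_tmul, act_apply, map_smul, coordHom_smul, map_smul]
  exact LinearMap.congr_fun this x

lemma ofCoord_transl (g : Γ) (x : I × Γ →₀ K) :
    ofCoord K π (transl K I g x) = actK K M g (ofCoord K π x) := by
  have : ofCoord K π ∘ₗ transl K I g = actK K M g ∘ₗ ofCoord K π := by
    refine Finsupp.lhom_ext' fun ⟨b, y⟩ => LinearMap.ext_ring ?_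
    change ofCoord K π (transl K I g (Finsupp.single (b, y) 1)) =
      actK K M g (ofCoord K π (Finsupp.single (b, y) 1))
    rw [transl_single, ofCoord_single, ofCoord_single, LinearMap.baseChange_tmul, act_apply,
      ← map_smul, Finsupp.smul_single, smul_eq_mul, MonoidAlgebra.single_mul_single, one_mul]
  exact LinearMap.congr_fun this x

variable {M' : Type u} [AddCommGroup M'] [Module (MonoidAlgebra ℤ Γ) M']
  (d : M →ₗ[MonoidAlgebra ℤ Γ] M')

lemma baseChange_act (g : Γ) (x : K ⊗[ℤ] M) :
    d.toInt.baseChange K (actK K M g x) = actK K M' g (d.toInt.baseChange K x) := by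
  have : d.toInt.baseChange K ∘ₗ actK K M g = actK K M' g ∘ₗ d.toInt.baseChange K := by
    refine TensorProduct.AlgebraTensorModule.ext fun a m => ?_
    simp only [LinearMap.comp_apply, LinearMap.baseChange_tmul, act_apply, LinearMap.toInt_apply,
      map_smul]
  exact LinearMap.congr_fun this x

variable {J : Type*} (i' : M' →ₗ[MonoidAlgebra ℤ Γ] (J →₀ MonoidAlgebra ℤ Γ))

/-- A homomorphism of finitely generated projective modules in coordinates. -/
def coordMap : (I × Γ →₀ K) →ₗ[K] (J × Γ →₀ K) :=
  coord K i' ∘ₗ d.toInt.baseChange K ∘ₗ ofCoord K π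

lemma coordMap_apply (x : I × Γ →₀ K) :
    coordMap K π d i' x = coord K i' (d.toInt.baseChange K (ofCoord K π x)) := rfl

lemma coordMap_transl (g : Γ) (x : I × Γ →₀ K) :
    coordMap K π d i' (transl K I g x) = transl K J g (coordMap K π d i' x) := by
  rw [coordMap_apply, ofCoord_transl, baseChange_act, coord_act]
  rfl

/-- In the base change of a module to `K`, the scalar extension of a generating set spans. -/
lemma span_tmul_eq_top {C : Type*} (w : C → M)
    (hw : Submodule.span (MonoidAlgebra ℤ Γ) (Set.range w) = ⊤) :
    Submodule.span K (Set.range fun x : C × Γ =>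
      actK K M x.2 ((1 : K) ⊗ₜ w x.1)) = ⊤ := by
  set W := Submodule.span K (Set.range fun x : C × Γ => actK K M x.2 ((1 : K) ⊗ₜ w x.1))
  have key : ∀ m : M, (1 : K) ⊗ₜ[ℤ] m ∈ W := fun m => by
    have hm : m ∈ Submodule.span (MonoidAlgebra ℤ Γ) (Set.range w) := hw ▸ Submodule.mem_top
    rw [Finsupp.mem_span_range_iff_exists_finsupp] at hm
    obtain ⟨z, rfl⟩ := hm
    have : (W.mkQ.toAddMonoidHom.comp (TensorProduct.mk ℤ K M 1).toAddMonoidHom).comp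
        (Finsupp.linearCombination (MonoidAlgebra ℤ Γ) w).toAddMonoidHom = 0 := by
      refine addHom_ext_basis fun c γ => ?_
      simp only [AddMonoidHom.comp_apply, LinearMap.toAddMonoidHom_coe,
        Finsupp.linearCombination_single]
      exact (Submodule.Quotient.mk_eq_zero _).2 (Submodule.subset_span ⟨(c, γ), rfl⟩)
    exact (Submodule.Quotient.mk_eq_zero _).1 (DFunLike.congr_fun this z)
  rw [eq_top_iff]
  rintro x -
  induction x using TensorProduct.induction_on with
  | zero => exact zero_mem _
  | add x y hx hy => exact add_mem hx hy
  | tmul a m =>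
    have := W.smul_mem a (key m)
    rwa [TensorProduct.smul_tmul', smul_eq_mul, mul_one] at this

end Coordinates

section Resolution

variable (P : ProjectiveResolution (trivialModule Γ)) (j : ℕ) {I J : Type}
  (i : P.complex.X (j + 1) →ₗ[MonoidAlgebra ℤ Γ] (I →₀ MonoidAlgebra ℤ Γ))
  (π : (I →₀ MonoidAlgebra ℤ Γ) →ₗ[MonoidAlgebra ℤ Γ] P.complex.X (j + 1))
  (h : ∀ m, π (i m) = m)
  (i' : P.complex.X j →ₗ[MonoidAlgebra ℤ Γ] (J →₀ MonoidAlgebra ℤ Γ))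
  (π' : (J →₀ MonoidAlgebra ℤ Γ) →ₗ[MonoidAlgebra ℤ Γ] P.complex.X j)
  (h' : ∀ m, π' (i' m) = m)

/-- The differential of a resolution in coordinates. -/
abbrev coordD : (I × Γ →₀ K) →ₗ[K] (J × Γ →₀ K) := coordMap K π (P.complex.d (j + 1) j).hom i'

/-- The differential of the base change of a resolution. -/
abbrev dK (n m : ℕ) : K ⊗[ℤ] P.complex.X n →ₗ[K] K ⊗[ℤ] P.complex.X m :=
  (P.complex.d n m).hom.toInt.baseChange K

lemma dK_dK (n m l : ℕ) (x : K ⊗[ℤ] P.complex.X n) : dK K P m l (dK K P n m x) = 0 := by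
  have : dK K P m l ∘ₗ dK K P n m = 0 := by
    refine TensorProduct.AlgebraTensorModule.ext fun a m => ?_
    simp [P.d_d_apply]
  exact LinearMap.congr_fun this x

include h' in
lemma exists_dK_eq_ofCoord {y : I × Γ →₀ K} (hy : coordD K P j π i' y = 0) :
    ∃ w, dK K P (j + 2) (j + 1) w = ofCoord K π y := by
  -- Exactness concerns only the underlying modules; any group in the right universe would do for
  -- `G`.
  refine exists_d_eq (G := ULift.{max u v} Γ) K MulEquiv.ulift.toMonoidHom P j (ofCoord K π y) ?_
  have := congrArg (ofCoord K π') hy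
  rwa [coordMap_apply, ofCoord_coord K h', map_zero] at this

include h in
lemma coordD_coord (x : K ⊗[ℤ] P.complex.X (j + 1)) :
    coordD K P j π i' (coord K i x) = coord K i' (dK K P (j + 1) j x) := by
  rw [coordMap_apply, ofCoord_coord K h]

include h h' in
/-- The cycles of the differential in coordinates are generated by finitely many elements if
the next module of the resolution is finitely generated. -/
lemma ker_coordD_eq_span {C : Type*} (w : C → P.complex.X (j + 2))
    (hw : Submodule.span (MonoidAlgebra ℤ Γ) (Set.range w) = ⊤) :
    LinearMap.ker (coordD K P j π i') = Submodule.span K (Set.range fun x : (C ⊕ I) × Γ =>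
      transl K I x.2 (Sum.elim
        (fun c => coord K i (dK K P (j + 2) (j + 1) ((1 : K) ⊗ₜ w c)))
        (fun b => Finsupp.single (b, 1) 1 - coord K i (ofCoord K π (Finsupp.single (b, 1) 1)))
        x.1)) := by
  apply le_antisymm
  · intro y hy
    obtain ⟨v, hv⟩ := exists_dK_eq_ofCoord K P j π i' π' h' hy
    -- The first term is a boundary, spanned by the images of the generators `w`. The second lies in
    -- the complement of the retract, spanned by translates of the vectors indexed by `I`.
    have hy' : y = coord K i (dK K P (j + 2) (j + 1) v) + (y - coord K i (ofCoord K π y)) := by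
      rw [hv]; abel
    rw [hy']
    refine add_mem ?_ ?_
    · have hvW : v ∈ Submodule.span K (Set.range fun x : C × Γ =>
          actK K (P.complex.X (j + 2)) x.2 ((1 : K) ⊗ₜ w x.1)) := by
        rw [span_tmul_eq_top K w hw]; trivial
      clear hv hy'
      induction hvW using Submodule.span_induction with
      | mem x hx =>
        obtain ⟨⟨c, g⟩, rfl⟩ := hx
        refine Submodule.subset_span ⟨(Sum.inl c, g), ?_⟩
        simp only [Sum.elim_inl]
        rw [baseChange_act, coord_act]
      | zero => rw [map_zero, map_zero]; exact zero_mem _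
      | add x y _ _ hx hy => rw [map_add, map_add]; exact add_mem hx hy
      | smul a x _ hx => rw [map_smul, map_smul]; exact Submodule.smul_mem _ _ hx
    · clear hy' hv hy
      induction y using Finsupp.induction_linear with
      | zero => rw [map_zero, map_zero, sub_zero]; exact zero_mem _
      | add x y hx hy =>
        rw [map_add, map_add, add_sub_add_comm]
        exact add_mem hx hy
      | single b a =>
        obtain ⟨b, g⟩ := b
        have e1 : Finsupp.single (b, g) a = a • transl K I g (Finsupp.single (b, 1) 1) := by
          rw [transl_single, mul_one, Finsupp.smul_single, smul_eq_mul, mul_one]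
        rw [e1, map_smul, map_smul, ← smul_sub, ofCoord_transl, coord_act, ← map_sub]
        exact Submodule.smul_mem _ _ (Submodule.subset_span ⟨(Sum.inr b, g), rfl⟩)
  · rw [Submodule.span_le]
    rintro - ⟨⟨c | b, g⟩, rfl⟩
    · simp only [Sum.elim_inl, SetLike.mem_coe, LinearMap.mem_ker]
      rw [coordMap_transl, coordD_coord K P j i π h, dK_dK, map_zero, map_zero]
    · simp only [Sum.elim_inr, SetLike.mem_coe, LinearMap.mem_ker]
      rw [coordMap_transl, map_sub, coordD_coord K P j i π h, coordMap_apply, sub_self, map_zero]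

variable (Λ : Subgroup Γ)

/-- The inclusion of a subgroup, with a universe lift. -/
abbrev inclusion : ULift.{v} Λ →* Γ := Λ.subtype.comp MulEquiv.ulift.toMonoidHom

lemma inclusion_injective : Function.Injective (inclusion.{u, v} Λ) :=
  Subtype.val_injective.comp ULift.down_injective

variable [Λ.Normal]

lemma proj_eq_zero_of_mem_ker {M : Type u} [AddCommGroup M] [Module (MonoidAlgebra ℤ Γ) M]
    {I : Type*} (i : M →ₗ[MonoidAlgebra ℤ Γ] (I →₀ MonoidAlgebra ℤ Γ)) {x : K ⊗[ℤ] M}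
    (hx : x ∈ Coinvariants.ker (rep K (inclusion.{u, v} Λ) M)) :
    proj K I (QuotientGroup.mk' Λ) (coord K i x) = 0 := by
  have : Coinvariants.ker (rep K (inclusion.{u, v} Λ) M) ≤
      LinearMap.ker (proj K I (QuotientGroup.mk' Λ) ∘ₗ coord K i) := by
    refine Submodule.span_le.2 ?_
    rintro - ⟨⟨g, x⟩, rfl⟩
    change proj K I (QuotientGroup.mk' Λ) (coord K i (actK K M (inclusion Λ g) x - x)) = 0
    have hg : QuotientGroup.mk' Λ (inclusion Λ g) = 1 :=
      (QuotientGroup.eq_one_iff _).2 g.down.2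
    rw [map_sub, coord_act, map_sub, proj_transl, hg, sub_eq_zero]
    simp [transl, Finsupp.lmapDomain_apply]
    exact Finsupp.mapDomain_id
  exact this hx

/-- Elements of `Γ` in the same coset differ by left multiplication by `Λ`, since `Λ` is normal.
Hence passing from coordinates to coinvariants factors through `proj`, via `β`. -/
lemma ofCoord_mem_ker_of_proj_eq_zero {M : Type u} [AddCommGroup M]
    [Module (MonoidAlgebra ℤ Γ) M] {I : Type*}
    (π : (I →₀ MonoidAlgebra ℤ Γ) →ₗ[MonoidAlgebra ℤ Γ] M) {y : I × Γ →₀ K}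
    (hy : proj K I (QuotientGroup.mk' Λ) y = 0) :
    ofCoord K π y ∈ Coinvariants.ker (rep K (inclusion.{u, v} Λ) M) := by
  let β : (I × (Γ ⧸ Λ) →₀ K) →ₗ[K] (rep K (inclusion.{u, v} Λ) M).Coinvariants :=
    Finsupp.linearCombination K fun x =>
      Coinvariants.mk _ (ofCoord K π (Finsupp.single (x.1, x.2.out) 1))
  have : β ∘ₗ proj K I (QuotientGroup.mk' Λ) = Coinvariants.mk _ ∘ₗ ofCoord K π := by
    refine Finsupp.lhom_ext' fun ⟨b, g⟩ => LinearMap.ext_ring ?_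
    change β (proj K I (QuotientGroup.mk' Λ) (Finsupp.single (b, g) 1)) =
      Coinvariants.mk _ (ofCoord K π (Finsupp.single (b, g) 1))
    rw [proj_single]
    simp only [β, Finsupp.linearCombination_single, one_smul]
    set g' := (QuotientGroup.mk' Λ g).out
    have hg' : g' * g⁻¹ ∈ Λ := by
      rw [← QuotientGroup.eq_one_iff, QuotientGroup.mk_mul, QuotientGroup.mk_inv,
        mul_inv_eq_one]
      exact QuotientGroup.out_eq' _
    have e1 : (Finsupp.single (b, g') 1 : I × Γ →₀ K) =
        transl K I (inclusion.{u, v} Λ ⟨g' * g⁻¹, hg'⟩) (Finsupp.single (b, g) 1) := by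
      rw [transl_single]
      exact congrArg (fun x => Finsupp.single (b, x) (1 : K)) (inv_mul_cancel_right g' g).symm
    rw [e1, ofCoord_transl]
    exact Coinvariants.mk_self_apply (rep K (inclusion.{u, v} Λ) M) _ _
  have h0 := LinearMap.congr_fun this y
  rw [LinearMap.comp_apply, LinearMap.comp_apply, hy, map_zero] at h0
  exact (Coinvariants.mk_eq_zero _).1 h0.symm

include h h' in
/-- The homology of a finite index normal subgroup embeds into an explicit quotient of a free
module over the finite quotient group. -/
theorem exists_injective_groupHomology :
    ∃ φ : groupHomology (Rep.trivial K (ULift.{v} Λ) K) (j + 1) →ₗ[K]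
        (I × (Γ ⧸ Λ) →₀ K) ⧸
          (LinearMap.ker (coordD K P j π i')).map (proj K I (QuotientGroup.mk' Λ)),
      Function.Injective φ ∧ ∀ z, ∃ y,
        proj K J (QuotientGroup.mk' Λ) (coordD K P j π i' y) = 0 ∧
        φ z = Submodule.mkQ _ (proj K I (QuotientGroup.mk' Λ) y) := by
  obtain ⟨φ, hφ, hφ'⟩ := groupHomology.exists_injective
    (resolution K (inclusion.{u, v} Λ) P (inclusion_injective Λ)) j
    ((LinearMap.ker (coordD K P j π i')).map (proj K I (QuotientGroup.mk' Λ)))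
    (proj K I (QuotientGroup.mk' Λ) ∘ₗ coord K i) (fun g x => by
      rw [← sub_eq_zero, ← map_sub]
      exact proj_eq_zero_of_mem_ker.{u, v} K Λ i (Coinvariants.sub_mem_ker g x))
    (fun y => by
      refine ⟨coord K i (dK K P (j + 2) (j + 1) y), ?_, rfl⟩
      rw [SetLike.mem_coe, LinearMap.mem_ker, coordD_coord K P j i π h]
      exact (congrArg (coord K i') (dK_dK K P _ _ _ y)).trans (map_zero _))
    (fun x hx => by
      obtain ⟨y, hy, hxy⟩ := hx
      obtain ⟨w, hw⟩ := exists_dK_eq_ofCoord K P j π i' π' h' hy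
      refine ⟨w, ?_⟩
      have hw' : dK K P (j + 2) (j + 1) w = ofCoord K π y := hw
      have hx' : ofCoord K π (coord K i x) = x := ofCoord_coord K h x
      have := ofCoord_mem_ker_of_proj_eq_zero.{u, v} K Λ π (y := coord K i x - y) (by
        rw [map_sub, hxy]; exact sub_self _)
      rw [map_sub, hx', ← hw'] at this
      exact this)
  refine ⟨φ, hφ, fun z => ?_⟩
  obtain ⟨x, hx, hz⟩ := hφ' z
  refine ⟨coord K i x, ?_, hz⟩
  exact (congrArg (proj K J (QuotientGroup.mk' Λ)) (coordD_coord K P j i π h i' x)).trans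
    (proj_eq_zero_of_mem_ker.{u, v} K Λ i' hx)

end Resolution

end GroupRingBaseChange

/-! ### Approximate partitions of the finite quotients of an amenable group -/

lemma IsResidualChain.eventually_eq_one {Γ : Type u} [Group Γ] {Λ : ℕ → Subgroup Γ}
    (hΛ : IsResidualChain Λ) (T : Set Γ) (hT : T.Finite) :
    ∀ᶠ i in atTop, ∀ t ∈ T, t ∈ Λ i → t = 1 := by
  rw [hT.eventually_all]
  intro t _
  by_cases ht : t = 1
  · exact Eventually.of_forall fun _ _ => ht
  · have : t ∉ ⨅ i, Λ i := by rwa [hΛ.iInf_eq_bot, Subgroup.mem_bot]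
    rw [Subgroup.mem_iInf, not_forall] at this
    obtain ⟨i, hi⟩ := this
    filter_upwards [eventually_ge_atTop i] with k hk h
    exact absurd (hΛ.antitone hk h) hi

lemma IsResidualChain.eventually_injOn {Γ : Type u} [Group Γ] {Λ : ℕ → Subgroup Γ}
    (hΛ : IsResidualChain Λ) (A : Set Γ) (hA : A.Finite) :
    ∀ᶠ i in atTop, A.InjOn (QuotientGroup.mk : Γ → Γ ⧸ Λ i) := by
  have := hΛ.eventually_eq_one (Set.image2 (fun a b => a⁻¹ * b) A A) (hA.image2 _ hA)
  filter_upwards [this] with i hi a ha b hb hab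
  exact inv_mul_eq_one.1 (hi _ ⟨a, ha, b, hb, rfl⟩ (QuotientGroup.eq.1 hab))

/-- Injectivity on `F` preserves its cardinality in the quotient, while the boundary can only
shrink, so the image of `F` is as good a Følner set as `F`. -/
lemma exists_folner_partition {Γ : Type u} [Group Γ] {S F : Finset Γ} (hF : F.Nonempty) {ε : ℝ}
    (hb : ((folnerBoundary (S : Set Γ) F).ncard : ℝ) ≤ ε * F.card) (Λ : Subgroup Γ) [Λ.Normal]
    [Λ.FiniteIndex] (hinj : (F : Set Γ).InjOn (QuotientGroup.mk : Γ → Γ ⧸ Λ)) :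
    ∃ a : Γ ⧸ Λ → Γ ⧸ Λ, (∀ x, ∃ f ∈ F, x = a x * QuotientGroup.mk' Λ f) ∧
      (({x | ¬ ∀ s ∈ S, a (x * QuotientGroup.mk' Λ s) = a x} : Set (Γ ⧸ Λ)).ncard : ℝ) ≤
        2 * ε * S.card * Λ.index := by
  classical
  have : Fintype (Γ ⧸ Λ) := Fintype.ofFinite _
  let p := QuotientGroup.mk' Λ
  have hfin : (folnerBoundary (S : Set Γ) (F : Set Γ)).Finite :=
    F.finite_toSet.subset fun x hx => hx.1
  obtain ⟨a, ha, hbad⟩ := RandomOrder.exists_partition (hF.image p) (S.image p)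
    (folnerBoundary (S : Set Γ) (F : Set Γ)).ncard (by
      intro s hs
      obtain ⟨s, hs', rfl⟩ := Finset.mem_image.1 hs
      rw [Set.ncard_eq_toFinset_card _ hfin]
      refine (Finset.card_le_card (t := hfin.toFinset.image p) fun x hx => ?_).trans
        Finset.card_image_le
      obtain ⟨hx, hx'⟩ := Finset.mem_filter.1 hx
      obtain ⟨f, hf, rfl⟩ := Finset.mem_image.1 hx
      refine Finset.mem_image.2 ⟨f, hfin.mem_toFinset.2 ⟨hf, s, hs', fun hfs => hx' ?_⟩, rfl⟩
      exact Finset.mem_image.2 ⟨f * s, hfs, map_mul p f s⟩)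
  have hcard : (F.image p).card = F.card := Finset.card_image_of_injOn hinj
  refine ⟨a, fun x => ?_, ?_⟩
  · obtain ⟨f, hf, hx⟩ := ha x
    obtain ⟨f, hf', rfl⟩ := Finset.mem_image.1 hf
    exact ⟨f, hf', hx⟩
  · have hset : ({x | ¬ ∀ s ∈ S, a (x * p s) = a x} : Set (Γ ⧸ Λ)) =
        (Finset.univ.filter fun x => ∃ s ∈ S.image p, a (x * s) ≠ a x : Finset (Γ ⧸ Λ)) := by
      ext x
      simp
    change (({x | ¬ ∀ s ∈ S, a (x * p s) = a x} : Set (Γ ⧸ Λ)).ncard : ℝ) ≤ _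
    rw [hset, Set.ncard_coe_finset]
    rw [hcard] at hbad
    have hF0 : (0 : ℝ) < F.card := by exact_mod_cast hF.card_pos
    have hS : ((S.image p).card : ℝ) ≤ S.card := by exact_mod_cast Finset.card_image_le
    have hidx : (Fintype.card (Γ ⧸ Λ) : ℝ) = Λ.index := by
      rw [Subgroup.index, Nat.card_eq_fintype_card]
    have hbad' : (F.card : ℝ) * (Finset.univ.filter fun x => ∃ s ∈ S.image p, a (x * s) ≠ a x).card
        ≤ 2 * (folnerBoundary (S : Set Γ) (F : Set Γ)).ncard * (S.image p).card * Λ.index := by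
      rw [← hidx]; exact_mod_cast hbad
    have h0 : 0 ≤ ε * F.card := (Nat.cast_nonneg _).trans hb
    refine le_of_mul_le_mul_left (hbad'.trans ?_) hF0
    calc 2 * ((folnerBoundary (S : Set Γ) (F : Set Γ)).ncard : ℝ) * (S.image p).card * Λ.index
        ≤ 2 * (ε * F.card) * S.card * Λ.index := by gcongr
      _ = F.card * (2 * ε * S.card * Λ.index) := by ring

/-- The finite quotients of an amenable group along a residual chain can be partitioned into
subsets of translates of a fixed finite set, such that few elements are close to the boundary
of their piece. -/
lemma IsResidualChain.exists_eventually_partition {Γ : Type u} [Group Γ] (ham : IsAmenable Γ)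
    {Λ : ℕ → Subgroup Γ} (hΛ : IsResidualChain Λ) (S : Finset Γ) {ε : ℝ} (hε : 0 < ε) :
    ∃ F : Finset Γ, ∀ᶠ i in atTop, ∀ _ : (Λ i).Normal,
      (∀ f ∈ F, ∀ s ∈ S, ∀ f' ∈ F, ∀ s' ∈ S,
        QuotientGroup.mk' (Λ i) (f * s) = QuotientGroup.mk' (Λ i) (f' * s') → f * s = f' * s') ∧
      ∃ a : Γ ⧸ Λ i → Γ ⧸ Λ i, (∀ x, ∃ f ∈ F, x = a x * QuotientGroup.mk' (Λ i) f) ∧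
        (({x | ¬ ∀ s ∈ S, a (x * QuotientGroup.mk' (Λ i) s) = a x} : Set (Γ ⧸ Λ i)).ncard : ℝ) ≤
          ε * (Λ i).index := by
  classical
  -- This absorbs the factor `2 * S.card` of `exists_folner_partition`; the `+ 1` covers empty `S`.
  obtain ⟨F, hF, hb⟩ := ham S (ε / (2 * (S.card + 1))) (by positivity)
  refine ⟨F, ?_⟩
  filter_upwards [hΛ.eventually_injOn F F.finite_toSet,
    hΛ.eventually_injOn _ (F.finite_toSet.image2 (fun f s => f * s) S.finite_toSet)] with i h1 h2 _
  refine ⟨fun f hf s hs f' hf' s' hs' h => h2 ⟨f, hf, s, hs, rfl⟩ ⟨f', hf', s', hs', rfl⟩ h, ?_⟩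
  have := hΛ.finiteIndex i
  obtain ⟨a, ha, hbad⟩ := exists_folner_partition hF hb (Λ i) h1
  refine ⟨a, ha, hbad.trans ?_⟩
  have : 2 * (ε / (2 * ((S.card : ℝ) + 1))) * S.card ≤ ε := by
    have h0 : (0 : ℝ) < S.card + 1 := by positivity
    calc 2 * (ε / (2 * ((S.card : ℝ) + 1))) * S.card = ε * (S.card / (S.card + 1)) := by
          field_simp
      _ ≤ ε * 1 := by
          gcongr
          rw [div_le_one h0]
          linarith
      _ = ε := mul_one _
  gcongr

/-! ### Dimension and torsion bounds -/

namespace FreeModule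

variable {K : Type*} [CommRing K] {I : Type*} {Γ Q : Type*} [Group Γ] [Group Q]

lemma rank_quotient_le {K : Type (max u v)} [Field K] {I : Type} [Fintype I] {Q : Type u} [Finite Q]
    (N : Submodule K (I × Q →₀ K)) (bad : Set Q) :
    Module.rank K ((I × Q →₀ K) ⧸ (N ⊔ Finsupp.supported K K {y : I × Q | y.2 ∉ bad})) ≤
      ((Fintype.card I * bad.ncard : ℕ) : Cardinal.{max u v}) := by
  classical
  let s : Set (I × Q) := Set.univ ×ˢ bad
  let g : (s →₀ K) →ₗ[K] (I × Q →₀ K) ⧸ (N ⊔ Finsupp.supported K K {y : I × Q | y.2 ∉ bad}) :=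
    Submodule.mkQ _ ∘ₗ Finsupp.lmapDomain K K Subtype.val
  have hg : Function.Surjective g := fun m => by
    obtain ⟨x, rfl⟩ := Submodule.mkQ_surjective _ m
    induction x using Finsupp.induction_linear with
    | zero => exact ⟨0, by rw [map_zero, map_zero]⟩
    | add x y hx hy =>
      obtain ⟨a, ha⟩ := hx
      obtain ⟨b, hb⟩ := hy
      exact ⟨a + b, by rw [map_add, map_add, ha, hb]⟩
    | single y a =>
      by_cases hy : y ∈ s
      · refine ⟨Finsupp.single ⟨y, hy⟩ a, ?_⟩
        simp [g]
      · refine ⟨0, ?_⟩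
        rw [map_zero, eq_comm]
        refine (Submodule.Quotient.mk_eq_zero _).2 (Submodule.mem_sup_right ?_)
        refine Finsupp.single_mem_supported K a fun h => hy ⟨trivial, h⟩
  refine (LinearMap.rank_le_of_surjective g hg).trans ?_
  rw [rank_finsupp_self]
  have : Nat.card s = Fintype.card I * bad.ncard := by
    rw [Nat.card_coe_set_eq, Set.ncard_prod, Set.ncard_univ, Nat.card_eq_fintype_card]
  rw [← this, ← Nat.cast_card (α := s), Cardinal.lift_natCast]

open Classical in
lemma sum_natAbs_mapDomain_le (e : K ≃+* ℤ) {α β : Type*} [Fintype β] (f : α → β) (x : α →₀ K) :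
    ∑ y, (e (x.mapDomain f y)).natAbs ≤ ∑ z ∈ x.support, (e (x z)).natAbs := by
  have h1 : ∀ y, (e (x.mapDomain f y)).natAbs ≤
      ∑ z ∈ x.support, if f z = y then (e (x z)).natAbs else 0 := fun y => by
    rw [Finsupp.mapDomain, Finsupp.sum, Finsupp.finsetSum_apply, map_sum]
    refine (Int.natAbs_sum_le _ _).trans (Finset.sum_le_sum fun z _ => ?_)
    rw [Finsupp.single_apply]
    split_ifs <;> simp
  calc _ ≤ ∑ y, ∑ z ∈ x.support, if f z = y then (e (x z)).natAbs else 0 :=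
        Finset.sum_le_sum fun y _ => h1 y
    _ = ∑ z ∈ x.support, ∑ y, if f z = y then (e (x z)).natAbs else 0 := Finset.sum_comm
    _ = _ := by simp

/-- A quotient of a free module over a finite group by translates of finitely many integral
vectors has a number of torsion elements which is exponential in the number of generators. -/
theorem card_torsion_quotient_le (e : K ≃+* ℤ) [Fintype I] [Finite Q] (p : Γ →* Q)
    {C : Type*} [Fintype C] (T : C → (I × Γ →₀ K)) {W : Submodule K (I × Γ →₀ K)}
    (hW : W = Submodule.span K (Set.range fun x : C × Γ => transl K I x.2 (T x.1)))
    (bad : Set Q) :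
    Finite (AddCommGroup.torsion ((I × Q →₀ K) ⧸
      (W.map (proj K I p) ⊔
        Finsupp.supported K K {y : I × Q | y.2 ∉ bad}))) ∧
    Nat.card (AddCommGroup.torsion ((I × Q →₀ K) ⧸
      (W.map (proj K I p) ⊔
        Finsupp.supported K K {y : I × Q | y.2 ∉ bad}))) ≤
      (1 + ∑ t, ∑ z ∈ (T t).support, (e (T t z)).natAbs) ^ (Fintype.card I * bad.ncard) := by
  classical
  cases nonempty_fintype Q
  subst hW
  set N := (Submodule.span K (Set.range fun x : C × Γ => transl K I x.2 (T x.1))).map (proj K I p)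
    with hN
  set E := Finsupp.supported K K {y : I × Q | y.2 ∉ bad} with hE
  let B := {y : I × Q // y ∈ (Set.univ : Set I) ×ˢ bad}
  let θ : (I × Q →₀ K) →ₗ[ℤ] (B → ℤ) := AddMonoidHom.toIntLinearMap
    { toFun := fun v y => e (v y)
      map_zero' := by ext; simp
      map_add' := fun x y => by ext; simp }
  let lam : (B → ℤ) →ₗ[ℤ] (I × Q →₀ K) := AddMonoidHom.toIntLinearMap
    { toFun := fun z => ∑ y : B, Finsupp.single (y : I × Q) (e.symm (z y))
      map_zero' := by simp
      map_add' := fun x y => by simp [Finset.sum_add_distrib] }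
  have hθl : ∀ z, θ (lam z) = z := fun z => by
    ext y
    change e ((∑ y : B, Finsupp.single (y : I × Q) (e.symm (z y))) y) = z y
    rw [Finsupp.finsetSum_apply, map_sum]
    rw [Finset.sum_eq_single y (fun x _ hx => by
      rw [Finsupp.single_eq_of_ne (fun h => hx (Subtype.ext h.symm)), map_zero]) (by simp)]
    simp
  have hlθ : ∀ v, v - lam (θ v) ∈ E := fun v => by
    rw [hE, Finsupp.mem_supported']
    intro y hy
    have hy' : y ∈ (Set.univ : Set I) ×ˢ bad := ⟨trivial, by simpa using hy⟩
    have := congrFun (hθl (θ v)) ⟨y, hy'⟩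
    change e _ = e (v y) at this
    rw [Finsupp.sub_apply, sub_eq_zero]
    exact (e.injective this).symm
  have hθE : ∀ v ∈ E, θ v = 0 := fun v hv => by
    ext y
    change e (v y) = 0
    rw [(Finsupp.mem_supported' K v).1 hv y (by simpa using y.2.2), map_zero]
  let ψ : (B → ℤ) →ₗ[ℤ] (I × Q →₀ K) ⧸ (N ⊔ E) := (N ⊔ E).mkQ.toInt ∘ₗ lam
  have hψ : Function.Surjective ψ := fun m => by
    obtain ⟨v, rfl⟩ := Submodule.mkQ_surjective _ m
    refine ⟨θ v, ?_⟩
    rw [eq_comm]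
    refine (Submodule.Quotient.eq _).2 (Submodule.mem_sup_right (hlθ v))
  let R : Set (B → ℤ) := Set.range fun x : C × Γ => θ (proj K I p (transl K I x.2 (T x.1)))
  -- Translation permutes coordinates, projection merges them and restriction drops some, so the
  -- bound depends neither on `g` nor on `Q`. The summand `1` keeps the base of the power positive.
  have hR : ∀ r ∈ R, ∑ b, (r b).natAbs ≤
      1 + ∑ t, ∑ z ∈ (T t).support, (e (T t z)).natAbs := by
    rintro - ⟨⟨t, g⟩, rfl⟩
    have h1 : proj K I p (transl K I g (T t)) =
        (T t).mapDomain fun x : I × Γ => (x.1, p (g * x.2)) :=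
      (Finsupp.mapDomain_comp (f := fun x : I × Γ => (x.1, g * x.2))
        (g := fun x : I × Γ => (x.1, p x.2))).symm
    simp only [h1]
    calc ∑ b : B, (e ((T t).mapDomain (fun x : I × Γ => (x.1, p (g * x.2))) (b : I × Q))).natAbs
        = ∑ b ∈ Finset.univ.filter (· ∈ (Set.univ : Set I) ×ˢ bad),
            (e ((T t).mapDomain (fun x : I × Γ => (x.1, p (g * x.2))) b)).natAbs :=
          (Finset.sum_subtype (Finset.univ.filter (· ∈ (Set.univ : Set I) ×ˢ bad))
            (fun x => by simp) fun b =>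
              (e ((T t).mapDomain (fun x : I × Γ => (x.1, p (g * x.2))) b)).natAbs).symm
      _ ≤ ∑ b, (e ((T t).mapDomain (fun x : I × Γ => (x.1, p (g * x.2))) b)).natAbs :=
          Finset.sum_le_sum_of_subset (Finset.filter_subset _ _)
      _ ≤ ∑ z ∈ (T t).support, (e (T t z)).natAbs := sum_natAbs_mapDomain_le e _ _
      _ ≤ ∑ t, ∑ z ∈ (T t).support, (e (T t z)).natAbs :=
          Finset.single_le_sum (f := fun t => ∑ z ∈ (T t).support, (e (T t z)).natAbs)
            (fun _ _ => Nat.zero_le _) (Finset.mem_univ t)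
      _ ≤ _ := Nat.le_add_left _ _
  have hker : LinearMap.ker ψ = Submodule.span ℤ R := by
    apply le_antisymm
    · intro z hz
      have hz' : lam z ∈ N ⊔ E := (Submodule.Quotient.mk_eq_zero _).1 hz
      obtain ⟨n, hn, w, hw, hnw⟩ := Submodule.mem_sup.1 hz'
      rw [← hθl z, ← hnw, map_add, hθE w hw, add_zero]
      clear hnw
      rw [hN, Submodule.map_span] at hn
      induction hn using Submodule.span_induction with
      | mem x hx =>
        obtain ⟨-, ⟨⟨t, g⟩, rfl⟩, rfl⟩ := hx
        exact Submodule.subset_span ⟨(t, g), rfl⟩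
      | zero => rw [map_zero]; exact zero_mem _
      | add x y _ _ hx hy => rw [map_add]; exact add_mem hx hy
      | smul a x _ hx =>
        have : θ (a • x) = e a • θ x := by
          ext y
          change e (a * x y) = e a * e (x y)
          rw [map_mul]
        rw [this]
        exact Submodule.smul_mem _ _ hx
    · rw [Submodule.span_le]
      rintro - ⟨⟨t, g⟩, rfl⟩
      refine (Submodule.Quotient.mk_eq_zero _).2 ?_
      have h1 := hlθ (proj K I p (transl K I g (T t)))
      have h2 : proj K I p (transl K I g (T t)) ∈ N :=
        ⟨_, Submodule.subset_span ⟨(t, g), rfl⟩, rfl⟩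
      have := sub_mem (show _ ∈ N ⊔ E from Submodule.mem_sup_left h2)
        (show _ ∈ N ⊔ E from Submodule.mem_sup_right h1)
      rwa [sub_sub_cancel] at this
  obtain ⟨hfin, hcard⟩ := card_torsion_le_pow (Nat.le_add_right 1 _) ψ hψ R hR hker
  refine ⟨hfin, hcard.trans (le_of_eq ?_)⟩
  congr 1
  rw [← Nat.card_eq_fintype_card, Nat.card_coe_set_eq, Set.ncard_prod, Set.ncard_univ,
    Nat.card_eq_fintype_card]

end FreeModule

/-! ### Vanishing of gradients -/

section Gradients

variable {Γ : Type u} [Group Γ] {Λ : ℕ → Subgroup Γ}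

lemma IsResidualChain.index_ne_zero (hΛ : IsResidualChain Λ) (k : ℕ) : (Λ k).index ≠ 0 :=
  (hΛ.finiteIndex k).index_ne_zero

lemma IsResidualChain.eventually_le_index [Infinite Γ] (hΛ : IsResidualChain Λ) (N : ℕ) :
    ∀ᶠ k in atTop, N ≤ (Λ k).index := by
  obtain ⟨A, rfl⟩ := Infinite.exists_subset_card_eq Γ N
  filter_upwards [hΛ.eventually_injOn A A.finite_toSet] with k hk
  have := hΛ.finiteIndex k
  have : Finite (A : Set Γ) := A.finite_toSet
  have h := Nat.card_le_card_of_injective _ hk.injective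
  rwa [Nat.card_coe_set_eq, Set.ncard_coe_finset] at h

/-- The constant `r` is fixed before `ε`, so it can be absorbed into `ε`. -/
lemma bettiGradient_eq_zero {F : Type v} [Field F] (hΛ : IsResidualChain Λ) {j r : ℕ}
    (h : ∀ ε : ℝ, 0 < ε → ∀ᶠ k in atTop, ∃ m : ℕ, (m : ℝ) ≤ ε * (Λ k).index ∧
      bettiNumber F (Λ k) j ≤ (r * m : ℕ)) : bettiGradient F Λ j = 0 := by
  refine le_antisymm (ENNReal.le_of_forall_pos_le_add fun ε hε _ => ?_) zero_le
  rw [zero_add]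
  refine limsup_le_of_le (by isBoundedDefault) ?_
  filter_upwards [h (ε / (r + 1)) (by positivity)] with k ⟨m, hm, hk⟩
  have hidx := hΛ.index_ne_zero k
  refine ENNReal.div_le_of_le_mul ?_
  calc ((bettiNumber F (Λ k) j : ℕ∞) : ℝ≥0∞) ≤ (((r * m : ℕ) : ℕ∞) : ℝ≥0∞) :=
        ENat.toENNReal_le.2 hk
    _ = ((r * m : NNReal) : ℝ≥0∞) := by simp
    _ ≤ ((ε * (Λ k).index : NNReal) : ℝ≥0∞) := by
        rw [ENNReal.coe_le_coe, ← NNReal.coe_le_coe]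
        push_cast
        have h1 : (0 : ℝ) < r + 1 := by positivity
        calc (r : ℝ) * m ≤ (r + 1) * (ε / (r + 1) * (Λ k).index) := by
              gcongr
              linarith
          _ = ε * (Λ k).index := by field_simp
    _ = ε * (Λ k).index := by simp

lemma torsionGradient_eq_zero (hΛ : IsResidualChain Λ) {j r c : ℕ} (hc : 1 ≤ c)
    (h : ∀ ε : ℝ, 0 < ε → ∀ᶠ k in atTop, ∃ m : ℕ, (m : ℝ) ≤ ε * (Λ k).index ∧
      torsionCard (Λ k) j ≤ (c ^ (r * m) : ℕ)) : torsionGradient Λ j = 0 := by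
  refine le_antisymm (EReal.le_of_forall_lt_iff_le.1 fun ε hε => ?_)
    (le_limsup_of_frequently_le (Frequently.of_forall fun k => ?_) (by isBoundedDefault))
  · have hε' : 0 < ε := by exact_mod_cast hε
    refine limsup_le_of_le (by isBoundedDefault) ?_
    have hc0 : 0 ≤ Real.log c := Real.log_natCast_nonneg c
    filter_upwards [h (ε / (r * Real.log c + 1)) (by positivity)] with k ⟨m, hm, hk⟩
    have hidx : (0 : ℝ) < (Λ k).index := by exact_mod_cast Nat.pos_of_ne_zero (hΛ.index_ne_zero k)
    have h1 : ENNReal.log (torsionCard (Λ k) j : ℝ≥0∞) ≤ ((r * m * Real.log c : ℝ) : EReal) := by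
      refine (ENNReal.log_monotone (ENat.toENNReal_le.2 hk)).trans (le_of_eq ?_)
      rw [ENat.toENNReal_coe, ENNReal.log_pos_real (by positivity) (ENNReal.natCast_ne_top _),
        ENNReal.toReal_natCast, Nat.cast_pow, Real.log_pow, Nat.cast_mul]
    refine (EReal.div_le_div_right_of_nonneg (by positivity) h1).trans ?_
    have h2 : (((Λ k).index : ℕ) : EReal) = (((Λ k).index : ℝ) : EReal) := rfl
    rw [h2, ← EReal.coe_div, EReal.coe_le_coe_iff, div_le_iff₀ hidx]
    have h3 : 0 < r * Real.log c + 1 := by positivity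
    calc r * m * Real.log c = (r * Real.log c) * m := by ring
      _ ≤ (r * Real.log c + 1) * (ε / (r * Real.log c + 1) * (Λ k).index) := by
          gcongr
          linarith
      _ = ε * (Λ k).index := by field_simp
  -- The torsion subgroup contains `0`, so its logarithm is nonnegative.
  · refine EReal.div_nonneg ?_ (by positivity)
    rw [ENNReal.zero_le_log_iff]
    have : (1 : ℕ∞) ≤ torsionCard (Λ k) j := by
      rw [torsionCard, ENat.one_le_card_iff_nonempty]
      infer_instance
    simpa using ENat.toENNReal_le.2 this

lemma bettiNumber_zero_le {F : Type v} [Field F] (G : Type u) [Group G] :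
    bettiNumber F G 0 ≤ 1 := by
  have e := (groupHomology.H0IsoOfIsTrivial
    (Rep.trivial (ULift.{u} F) (ULift.{v} G) (ULift.{u} F))).toLinearEquiv
  rw [bettiNumber, LinearEquiv.rank_eq e]
  exact le_of_eq ((congrArg Cardinal.toENat (Module.rank_self (ULift.{u} F))).trans (map_one _))

lemma torsionCard_zero_le (G : Type u) [Group G] : torsionCard G 0 ≤ 1 := by
  have e := (groupHomology.H0IsoOfIsTrivial
    (Rep.trivial (ULift.{u} ℤ) (ULift.{0} G) (ULift.{u} ℤ))).toLinearEquiv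
  rw [torsionCard, ENat.card_le_one_iff_subsingleton]
  refine ⟨fun x y => Subtype.ext ?_⟩
  have h0 : ∀ x : AddCommGroup.torsion (trivialHomology ℤ G 0), (x : trivialHomology ℤ G 0) = 0 :=
    fun x => by
      have h1 := AddMonoidHom.isOfFinAddOrder
        ((ULift.ringEquiv (R := ℤ)).toAddMonoidHom.comp e.toLinearMap.toAddMonoidHom) x.2
      have h2 := (isOfFinAddOrder_iff_eq_zero _).1 h1
      exact e.injective ((ULift.down_injective h2).trans (map_zero e).symm)
  rw [h0 x, h0 y]

end Gradients

lemma Module.Finite.exists_retract_finsupp (R M : Type*) [Ring R] [AddCommGroup M] [Module R M]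
    [Module.Finite R M] [Module.Projective R M] :
    ∃ (r : ℕ) (i : M →ₗ[R] (Fin r →₀ R)) (π : (Fin r →₀ R) →ₗ[R] M), ∀ m, π (i m) = m := by
  obtain ⟨r, f, g, -, -, h⟩ := Module.Finite.exists_comp_eq_id_of_projective R M
  let e := Finsupp.linearEquivFunOnFinite R R (Fin r)
  refine ⟨r, e.symm.toLinearMap ∘ₗ g, f ∘ₗ e.toLinearMap, fun m => ?_⟩
  simpa using LinearMap.congr_fun h m

/-! ### Homology survives the removal of the good basis vectors -/

namespace GroupRingBaseChange

open FreeModule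

variable {Γ : Type u} [Group Γ] (K : Type (max u v)) [CommRing K]
  (P : ProjectiveResolution (trivialModule Γ)) (j : ℕ) {I J : Type}
  {i : P.complex.X (j + 1) →ₗ[MonoidAlgebra ℤ Γ] (I →₀ MonoidAlgebra ℤ Γ)}
  {π : (I →₀ MonoidAlgebra ℤ Γ) →ₗ[MonoidAlgebra ℤ Γ] P.complex.X (j + 1)}
  (h : ∀ m, π (i m) = m)
  {i' : P.complex.X j →ₗ[MonoidAlgebra ℤ Γ] (J →₀ MonoidAlgebra ℤ Γ)}
  {π' : (J →₀ MonoidAlgebra ℤ Γ) →ₗ[MonoidAlgebra ℤ Γ] P.complex.X j}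
  (h' : ∀ m, π' (i' m) = m)

include h h' in
/-- If the finite quotient `Γ ⧸ Λ` is partitioned into small pieces, then the homology of `Λ`
embeds into a quotient of the free module supported on the boundaries of the pieces. -/
theorem exists_injective_of_partition (Λ : Subgroup Γ) [Λ.Normal] [Λ.FiniteIndex] {S F : Set Γ}
    (hS : ∀ b, ∀ y ∈ (coordD K P j π i' (Finsupp.single (b, 1) 1)).support, y.2 ∈ S)
    (hinj : ∀ f ∈ F, ∀ s ∈ S, ∀ f' ∈ F, ∀ s' ∈ S,
      QuotientGroup.mk' Λ (f * s) = QuotientGroup.mk' Λ (f' * s') → f * s = f' * s')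
    (a : Γ ⧸ Λ → Γ ⧸ Λ) (ha : ∀ x, ∃ f ∈ F, x = a x * QuotientGroup.mk' Λ f) :
    ∃ φ : groupHomology (Rep.trivial K (ULift.{v} Λ) K) (j + 1) →ₗ[K]
        (I × (Γ ⧸ Λ) →₀ K) ⧸
          ((LinearMap.ker (coordD K P j π i')).map (proj K I (QuotientGroup.mk' Λ)) ⊔
            Finsupp.supported K K {y : I × (Γ ⧸ Λ) |
              y.2 ∉ {x | ¬ ∀ s ∈ S, a (x * QuotientGroup.mk' Λ s) = a x}}),
      Function.Injective φ := by
  obtain ⟨φ, hφ, hφ'⟩ := exists_injective_groupHomology.{u, v} K P j i π h i' π' h' Λ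
  refine ⟨Submodule.factor le_sup_left ∘ₗ φ, ?_⟩
  refine (injective_iff_map_eq_zero _).2 fun z hz => hφ ?_
  obtain ⟨y, hy, hzy⟩ := hφ' z
  rw [LinearMap.comp_apply, hzy] at hz
  obtain ⟨n, ⟨n', hn', rfl⟩, e, he, hne⟩ :=
    Submodule.mem_sup.1 ((Submodule.Quotient.mk_eq_zero _).1 hz)
  replace hne : proj K I (QuotientGroup.mk' Λ) n' + e = proj K I (QuotientGroup.mk' Λ) y := hne
  have he' : e = proj K I (QuotientGroup.mk' Λ) (y - n') := by
    rw [map_sub, ← hne, add_sub_cancel_left]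
  have hδ := coordMap_transl K π (P.complex.d (j + 1) j).hom i'
  -- A class that dies is represented by a boundary plus `e`, with `e` supported off the bad set. As
  -- `e` is a cycle over the quotient, it lifts to a cycle over `Γ`, so the class was already zero.
  have hd : quotMap (QuotientGroup.mk' Λ) (coordD K P j π i') e = 0 := by
    rw [he', quotMap_proj _ hδ, map_sub, map_sub, hy, LinearMap.mem_ker.1 hn', map_zero, sub_zero]
  have heN := mem_map_ker_of_partition (QuotientGroup.mk' Λ) (QuotientGroup.mk'_surjective Λ) hδ
    hS hinj a ha (by simpa only [Set.mem_ofPred_eq, not_not] using he) hd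
  rw [hzy, map_zero, ← hne]
  exact (Submodule.Quotient.mk_eq_zero _).2 (add_mem ⟨n', hn', rfl⟩ heN)

include h h' in
/-- Along a residual chain in an amenable group, the homology embeds into quotients of free modules
supported on a small proportion of the finite quotients. -/
theorem exists_eventually_injective (ham : IsAmenable Γ) {Λ : ℕ → Subgroup Γ}
    (hΛ : IsResidualChain Λ) [Finite I] {ε : ℝ} (hε : 0 < ε) :
    ∀ᶠ k in atTop, ∀ _ : (Λ k).Normal, ∃ bad : Set (Γ ⧸ Λ k),
      (bad.ncard : ℝ) ≤ ε * (Λ k).index ∧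
      ∃ φ : groupHomology (Rep.trivial K (ULift.{v} (Λ k)) K) (j + 1) →ₗ[K]
        (I × (Γ ⧸ Λ k) →₀ K) ⧸
          ((LinearMap.ker (coordD K P j π i')).map (proj K I (QuotientGroup.mk' (Λ k))) ⊔
            Finsupp.supported K K {y : I × (Γ ⧸ Λ k) | y.2 ∉ bad}),
      Function.Injective φ := by
  classical
  cases nonempty_fintype I
  let S : Finset Γ := Finset.univ.biUnion fun b =>
    (coordD K P j π i' (Finsupp.single (b, 1) 1)).support.image Prod.snd
  have hS : ∀ b, ∀ y ∈ (coordD K P j π i' (Finsupp.single (b, 1) 1)).support, y.2 ∈ S :=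
    fun b y hy => Finset.mem_biUnion.2 ⟨b, Finset.mem_univ b, Finset.mem_image_of_mem _ hy⟩
  obtain ⟨F, hF⟩ := hΛ.exists_eventually_partition ham S hε
  filter_upwards [hF] with k hk _
  have := hΛ.finiteIndex k
  obtain ⟨hinj, a, ha, hbad⟩ := hk inferInstance
  exact ⟨_, hbad, exists_injective_of_partition K P j h h' (Λ k) hS hinj a ha⟩

end GroupRingBaseChange

/-! ### Vanishing of the gradients in positive degrees -/

section Gradients

open FreeModule GroupRingBaseChange

variable {Γ : Type u} [Group Γ] (ham : IsAmenable Γ) {Λ : ℕ → Subgroup Γ}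
  (hΛ : IsResidualChain Λ) (P : ProjectiveResolution (trivialModule Γ))

include ham hΛ in
theorem bettiGradient_succ_eq_zero (F : Type v) [Field F] (j : ℕ)
    [Module.Finite (MonoidAlgebra ℤ Γ) (P.complex.X j)]
    [Module.Finite (MonoidAlgebra ℤ Γ) (P.complex.X (j + 1))] :
    bettiGradient F Λ (j + 1) = 0 := by
  obtain ⟨r, i, π, h⟩ := Module.Finite.exists_retract_finsupp (MonoidAlgebra ℤ Γ)
    (P.complex.X (j + 1))
  obtain ⟨r', i', π', h'⟩ := Module.Finite.exists_retract_finsupp (MonoidAlgebra ℤ Γ)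
    (P.complex.X j)
  refine bettiGradient_eq_zero (r := r) hΛ fun ε hε => ?_
  filter_upwards [exists_eventually_injective.{u, v} (ULift.{u} F) P j h h' ham hΛ hε] with k hk
  have := hΛ.finiteIndex k
  have := hΛ.normal k
  obtain ⟨bad, hbad, φ, hφ⟩ := hk inferInstance
  refine ⟨bad.ncard, hbad, Cardinal.toENat_le_natCast.2 ?_⟩
  refine (LinearMap.rank_le_of_injective φ hφ).trans ((rank_quotient_le.{u, v} _ bad).trans ?_)
  rw [Fintype.card_fin]

include ham hΛ in
theorem torsionGradient_succ_eq_zero (j : ℕ)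
    [Module.Finite (MonoidAlgebra ℤ Γ) (P.complex.X j)]
    [Module.Finite (MonoidAlgebra ℤ Γ) (P.complex.X (j + 1))]
    [Module.Finite (MonoidAlgebra ℤ Γ) (P.complex.X (j + 2))] :
    torsionGradient Λ (j + 1) = 0 := by
  obtain ⟨r, i, π, h⟩ := Module.Finite.exists_retract_finsupp (MonoidAlgebra ℤ Γ)
    (P.complex.X (j + 1))
  obtain ⟨r', i', π', h'⟩ := Module.Finite.exists_retract_finsupp (MonoidAlgebra ℤ Γ)
    (P.complex.X j)
  obtain ⟨m, w, hw⟩ := Module.Finite.exists_fin (R := MonoidAlgebra ℤ Γ) (M := P.complex.X (j + 2))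
  obtain ⟨T, hT⟩ : ∃ T : Fin m ⊕ Fin r → (Fin r × Γ →₀ ULift.{u} ℤ),
      LinearMap.ker (coordD (ULift.{u} ℤ) P j π i') =
        Submodule.span (ULift.{u} ℤ) (Set.range fun x : (Fin m ⊕ Fin r) × Γ =>
          transl (ULift.{u} ℤ) (Fin r) x.2 (T x.1)) :=
    ⟨_, ker_coordD_eq_span.{u, 0} (ULift.{u} ℤ) P j i π h i' π' h' w hw⟩
  refine torsionGradient_eq_zero (r := r) hΛ (Nat.le_add_right 1
    (∑ t, ∑ z ∈ (T t).support, ((ULift.ringEquiv : ULift.{u} ℤ ≃+* ℤ) (T t z)).natAbs))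
    fun ε hε => ?_
  filter_upwards [exists_eventually_injective.{u, 0} (ULift.{u} ℤ) P j h h' ham hΛ hε] with k hk
  have := hΛ.finiteIndex k
  have := hΛ.normal k
  obtain ⟨bad, hbad, φ, hφ⟩ := hk inferInstance
  refine ⟨bad.ncard, hbad, ?_⟩
  obtain ⟨hfin, hcard⟩ := card_torsion_quotient_le (ULift.ringEquiv : ULift.{u} ℤ ≃+* ℤ)
    (QuotientGroup.mk' (Λ k)) T hT bad
  rw [Fintype.card_fin] at hcard
  refine le_trans ?_ (Nat.cast_le.2 hcard)
  rw [← ENat.card_eq_coe_natCard]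
  refine ENat.card_le_card_of_injective (f := fun x =>
    ⟨φ x, φ.toAddMonoidHom.isOfFinAddOrder x.2⟩) fun x y hxy => ?_
  exact Subtype.ext (hφ (congrArg Subtype.val hxy))

end Gradients

end

theorem mainTheorem11 (n : ℕ) (Γ : Type u) [Group Γ] [Infinite Γ]
    (hrf : IsResiduallyFinite Γ) (ham : IsAmenable Γ) (hfp : IsOfTypeFP Γ n) :
    MemT ((n : ℤ) - 1) Γ ∧ ∀ (F : Type v) [Field F], MemH F (n : ℤ) Γ := by
  obtain ⟨P, hP⟩ := hfp
  refine ⟨⟨hrf, fun Λ hΛ j hj => ?_⟩, fun F _ => ⟨hrf, fun Λ hΛ j hj => ?_⟩⟩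
  · cases j with
    | zero =>
      -- `H_0` is `ℤ`, which is torsion-free, so base `c = 1` and `m = 0` suffice.
      exact torsionGradient_eq_zero (r := 1) hΛ le_rfl fun ε hε => Eventually.of_forall fun k =>
        ⟨0, by push_cast; positivity, by simpa using torsionCard_zero_le (Λ k)⟩
    | succ j =>
      have := hP j (by omega)
      have := hP (j + 1) (by omega)
      have := hP (j + 2) (by omega)
      exact torsionGradient_succ_eq_zero ham hΛ P j
  · cases j with
    | zero =>
      -- `H_0` is one-dimensional, so the index has to tend to infinity; this is where the
      -- infinitude of `Γ` enters.
      refine bettiGradient_eq_zero (r := 1) hΛ fun ε hε => ?_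
      obtain ⟨N, hN⟩ := exists_nat_gt ε⁻¹
      filter_upwards [hΛ.eventually_le_index N] with k hk
      refine ⟨1, ?_, by simpa using bettiNumber_zero_le (Λ k)⟩
      have h1 : ε⁻¹ ≤ ((Λ k).index : ℝ) := hN.le.trans (by exact_mod_cast hk)
      rw [Nat.cast_one]
      exact (inv_le_iff_one_le_mul₀' hε).1 h1
    | succ j =>
      have := hP j (by omega)
      have := hP (j + 1) (by omega)
      exact bettiGradient_succ_eq_zero ham hΛ P F j
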